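/- **Setting.** For $i=1,\dots,9$ let $r=r_i$ be the unique root in $[a_i,a_i+\tfrac1{100})$ of the polynomial $p_i$, where - $p_1=x^4-10x^2-8x+9$, $a_1=0.63$; - $p_2=x^8-8x^7-44x^6-232x^5-482x^4-24x^3+388x^2-120x+9$, $a_2=0.54$; - $p_3=8x^3+3x^2-2x-1$, $a_3=0.53$; - $p_4=x^2+2x-1$, $a_4=0.41$; - $p_5=9x^4-12x^3-26x^2-12x+9$, $a_5=0.38$; - $p_6=x^4-28x^3-10x^2+4x+1$, $a_6=0.34$; - $p_7=2x^2+3x-1$, $a_7=0.28$; - $p_8=3x^2+6x-1$, $a_8=0.15$; - $p_9=x^2-10x+1$, $a_9=0.10$. These are the values of $r$ for which a compact packing by discs of radii $1$ and $r$ exists. Let $\mathcal P_i$ be the periodic compact packing whose triangles of mutually tangent discs have radii $(1,1,1)$, $(1,1,r)$, $(1,r,r)$, $(r,r,r)$ in the proportions $(0,3,1,0)$, $(2,6,3,1)$, $(0,2,4,0)$, $(0,4,0,0)$, $(0,6,6,6)$, $(0,0,12,2)$, $(0,4,2,0)$, $(0,6,0,0)$, $(0,6,6,2)$ for $i=1,\dots,9$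 respectively, and let $\delta_i$ be its density. A *packing by discs of radii $1$ and $r$* is a set of interior-disjoint closed discs of the plane whose radii lie in $\{1,r\}$; it is *saturated* if no disc of radius $1$ or $r$ can be added to it. The *cell* of a disc is the set of points at least as close to this disc as to any other disc of the packing. An *FM-triangulation* of the packing is a face-to-face triangulation of the plane by non-degenerate triangles whose vertices are the centres of the discs and which is dual to the cells: for each triangle, the cells of the discs centred at its three vertices have a common point. **Potentials in tight triangles.** A triangle is *tight* if the discs centred at its vertices are mutually tangent. Let $E_{abc}=\delta_i\cdot\mathrm{area}-\mathrm{cov}$ for a tight triangle with discs of radii $a,b,c$, where $\mathrm{cov}$ is the area of the part of the triangle inside its three discs. The numbers $V_{xqy}=V_{yqx}$ ($x,q,y\in\{1,r\}$) are the unique solution of $$3V_{111}=E_{111},\quad 3V_{rrr}=E_{rrr},\quad V_{r1r}+2V_{1rr}=E_{1rr},\quad V_{1r1}+2V_{11r}=E_{11r},$$ together with $V_{r1r}=0$ if $i\ne6$, $V_{1r1}=0$ if $i=6$, and the vanishing of the following two quantities (around a small and around a large disc of $\mathcal P_i$): - $i=1$: $3V_{1r1}+2V_{1rr}$ and $6V_{11r}+V_{r1r}$;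 - $i=2$: $V_{rrr}+2V_{1r1}+2V_{1rr}$ and $4V_{11r}+2V_{111}+V_{r1r}$; - $i=3$: $4V_{1rr}+V_{1r1}$ and $4V_{r1r}+4V_{11r}$; - $i=4$: $4V_{1r1}$ and $8V_{11r}$; - $i=5$: $V_{1r1}+2V_{1rr}+2\cdot\tfrac12E_{rrr}$ and $6V_{11r}+3V_{r1r}$; - $i=6$: $V_{rrr}+4V_{1rr}$ and $12V_{r1r}$; - $i=7$: $2V_{1rr}+2V_{1r1}$ and $8V_{11r}+2V_{r1r}$; - $i=8$: $3V_{1r1}$ and $12V_{11r}$; - $i=9$: $V_{rrr}+2V_{1rr}+V_{1r1}$ and $12V_{11r}+6V_{r1r}$. **Vertex potential.** Let $T$ be a triangle of an FM-triangulation $\mathcal T$ of a packing by discs of radii $1$ and $r$, let $v$ be a vertex of $T$, let $q$ be the radius of the disc centred at $v$ and $x,y$ the radii of the two other discs of $T$. Let $T^*$ be the tight triangle with the same discs as $T$, and let $\widehat v(T)$, $\widehat v(T^*)$ be the angles at $v$. Given $m_1,m_r$, put $$U_v(T)=W+m_q\,|\widehat v(T)-\widehat v(T^*)| ,$$ where $W=V_{xqy}$,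 except if $i=5$ and $x=q=y=r$. In this exceptional case, call a small disc *singular* if in $\mathcal T$ it is surrounded by exactly five discs, which are two large and three small ones in this cyclic order, and *regular* otherwise, and let $s$ be the number of singular discs of $T$. Then $W=\tfrac12E_{rrr}$ if the disc centred at $v$ is singular, and $W=(E_{rrr}-\tfrac s2E_{rrr})/(3-s)$ if it is regular. **Proposition.** Let $i\in\{1,\dots,9\}$, let $\mathcal T$ be an FM-triangulation of a saturated packing by discs of radii $1$ and $r_i$, and let $v$ be a vertex of $\mathcal T$. Suppose that $m_1$ and $m_r$ are at least the following values $(m_1,m_r)$: $i=1$: $(0,\,0.0005)$; $i=2$: $(0.16,\,0.087)$; $i=3$: $(0,\,0.00028)$; $i=4$: $(0,\,0.0021)$; $i=5$: $(0,\,0.048)$; $i=6$: $(0.0091,\,0.0021)$; $i=7$: $(0,\,0.0011)$; $i=8$: $(0,\,0.002)$; $i=9$: $(0,\,0.002058)$. Then $v$ belongs to finitely many triangles of $\mathcal T$, and $$\sum_{T\in\mathcal T,\ v\in T}U_v(T)\ \ge\ 0 .$$ -/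

import Mathlib

/-!
Disc packings of the plane by discs of radii `1` and `r`, their FM-triangulations
(additively weighted Delaunay triangulations), and the vertex potential.
-/

open scoped Classical

noncomputable section

namespace DiscPack

/-- The Euclidean plane. -/
abbrev Plane : Type := EuclideanSpace ℝ (Fin 2)

/-- The two kinds of discs: large (radius `1`) and small (radius `r`). -/
inductive DiscType where
  | large
  | small

open DiscType

/-- The radius of a disc of the given kind. -/
def DiscType.radius (r : ℝ) : DiscType → ℝ
  | large => 1
  | small => r

/-! ### The nine radii -/

/-- The nine polynomials of which the radii `r_1, …, r_9` are roots. -/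
def radiusPoly (i : ℕ) (x : ℝ) : ℝ :=
  match i with
  | 1 => x ^ 4 - 10 * x ^ 2 - 8 * x + 9
  | 2 => x ^ 8 - 8 * x ^ 7 - 44 * x ^ 6 - 232 * x ^ 5 - 482 * x ^ 4 - 24 * x ^ 3
      + 388 * x ^ 2 - 120 * x + 9
  | 3 => 8 * x ^ 3 + 3 * x ^ 2 - 2 * x - 1
  | 4 => x ^ 2 + 2 * x - 1
  | 5 => 9 * x ^ 4 - 12 * x ^ 3 - 26 * x ^ 2 - 12 * x + 9
  | 6 => x ^ 4 - 28 * x ^ 3 - 10 * x ^ 2 + 4 * x + 1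
  | 7 => 2 * x ^ 2 + 3 * x - 1
  | 8 => 3 * x ^ 2 + 6 * x - 1
  | 9 => x ^ 2 - 10 * x + 1
  | _ => 1

/-- The first two decimals of the radii. -/
def radiusApprox (i : ℕ) : ℝ :=
  match i with
  | 1 => 63 / 100
  | 2 => 54 / 100
  | 3 => 53 / 100
  | 4 => 41 / 100
  | 5 => 38 / 100
  | 6 => 34 / 100
  | 7 => 28 / 100
  | 8 => 15 / 100
  | 9 => 10 / 100
  | _ => 0

/-- `r` is the radius `r_i`: the only root of the `i`-th polynomial whose decimal expansion
starts with the given two decimals. -/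
def IsTargetRadius (i : ℕ) (r : ℝ) : Prop :=
  radiusPoly i r = 0 ∧ radiusApprox i ≤ r ∧ r < radiusApprox i + 1 / 100

/-! ### Tight triangles (three mutually tangent discs) -/

/-- In the triangle of centres of three mutually tangent discs of radii `a`, `b`, `c` (its sides
are `a + b`, `b + c`, `a + c`), the angle at the centre of the disc of radius `b`. -/
def tightAngle (a b c : ℝ) : ℝ :=
  Real.arccos (((b + a) ^ 2 + (b + c) ^ 2 - (a + c) ^ 2) / (2 * (b + a) * (b + c)))

/-- The area of that triangle (Heron's formula; the half perimeter is `a + b + c`). -/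
def tightArea (a b c : ℝ) : ℝ := Real.sqrt ((a + b + c) * a * b * c)

/-- The area of the part of that triangle which lies in the three discs: the total area of the
three disc sectors cut out by the angles of the triangle. -/
def tightCov (a b c : ℝ) : ℝ :=
  a ^ 2 * tightAngle b a c / 2 + b ^ 2 * tightAngle a b c / 2 + c ^ 2 * tightAngle a c b / 2

/-- The numbers of tight triangles with radii `(1,1,1)`, `(1,1,r)`, `(1,r,r)`, `(r,r,r)` in a
period of the target packing `P_i`. -/
def targetCount (i : ℕ) : ℝ × ℝ × ℝ × ℝ :=
  match i with
  | 1 => (0, 3, 1, 0)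
  | 2 => (2, 6, 3, 1)
  | 3 => (0, 2, 4, 0)
  | 4 => (0, 4, 0, 0)
  | 5 => (0, 6, 6, 6)
  | 6 => (0, 0, 12, 2)
  | 7 => (0, 4, 2, 0)
  | 8 => (0, 6, 0, 0)
  | 9 => (0, 6, 6, 2)
  | _ => (1, 0, 0, 0)

/-- Total of a quantity attached to tight triangles over a period of `P_i`. -/
def targetSum (i : ℕ) (r : ℝ) (f : ℝ → ℝ → ℝ → ℝ) : ℝ :=
  (targetCount i).1 * f 1 1 1 + (targetCount i).2.1 * f 1 1 r
    + (targetCount i).2.2.1 * f 1 r r + (targetCount i).2.2.2 * f r r r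

/-- The density `δ_i` of the target packing `P_i`: the area of a period inside the discs, divided
by the area of the period, both computed triangle by triangle. Its values are, for `i = 1, …, 9`,
`0.9106…`, `0.9116…`, `0.9141…`, `0.9201…`, `0.9200…`, `0.9246…`, `0.9319…`, `0.9503…`,
`0.9624…`. -/
def targetDensity (i : ℕ) (r : ℝ) : ℝ :=
  targetSum i r tightCov / targetSum i r tightArea

/-- The excess `E = δ_i · area - cov` of the tight triangle with the given discs. -/
def tightExcess (i : ℕ) (r : ℝ) (x y z : DiscType) : ℝ :=
  targetDensity i r * tightArea (x.radius r) (y.radius r) (z.radius r)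
    - tightCov (x.radius r) (y.radius r) (z.radius r)

/-! ### The potentials `V_{xqy}` in tight triangles -/

/-- The sum of the potentials around a small disc of the target packing `P_i` (around a
singular small disc if `i = 5`, whose potential in a triangle of three small discs is half of the
excess of that triangle). -/
def smallCorona (i : ℕ) (r : ℝ) (V : DiscType → DiscType → DiscType → ℝ) : ℝ :=
  match i with
  | 1 => 3 * V large small large + 2 * V large small small
  | 2 => V small small small + 2 * V large small large + 2 * V large small small
  | 3 => 4 * V large small small + V large small large
  | 4 => 4 * V large small large
  | 5 => V large small large + 2 * V large small small
      + 2 * (tightExcess 5 r small small small / 2)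
  | 6 => V small small small + 4 * V large small small
  | 7 => 2 * V large small small + 2 * V large small large
  | 8 => 3 * V large small large
  | 9 => V small small small + 2 * V large small small + V large small large
  | _ => 0

/-- The sum of the potentials around a large disc of the target packing `P_i`. -/
def largeCorona (i : ℕ) (V : DiscType → DiscType → DiscType → ℝ) : ℝ :=
  match i with
  | 1 => 6 * V large large small + V small large small
  | 2 => 4 * V large large small + 2 * V large large large + V small large small
  | 3 => 4 * V small large small + 4 * V large large small
  | 4 => 8 * V large large small
  | 5 => 6 * V large large small + 3 * V small large small
  | 6 => 12 * V small large small
  | 7 => 8 * V large large small + 2 * V small large small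
  | 8 => 12 * V large large small
  | 9 => 12 * V large large small + 6 * V small large small
  | _ => 0

/-- The conditions that characterize the potentials `V x q y` at the centre of the disc `q` in a
tight triangle with discs `x`, `q`, `y`. -/
structure IsTightPotential (i : ℕ) (r : ℝ) (V : DiscType → DiscType → DiscType → ℝ) : Prop where
  symm : ∀ x q y, V x q y = V y q x
  lll : 3 * V large large large = tightExcess i r large large large
  sss : 3 * V small small small = tightExcess i r small small small
  lss : V small large small + 2 * V large small small = tightExcess i r large small small
  lls : V large small large + 2 * V large large small = tightExcess i r large large small
  smallEq : smallCorona i r V = 0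
  largeEq : largeCorona i V = 0
  normalization : if i = 6 then V large small large = 0 else V small large small = 0

/-- The value `V_{11r}`. -/
def tightPotentialLLS (i : ℕ) (r : ℝ) : ℝ :=
  match i with
  | 2 => -tightExcess i r large large large / 6
  | 6 => tightExcess i r large large small / 2
  | _ => 0

/-- The potential `V_{xqy}` at the centre of the disc `q` in a tight triangle with discs `x`, `q`,
`y`: the unique solution of the conditions above, see `isTightPotential_iff`. -/
def tightPotential (i : ℕ) (r : ℝ) : DiscType → DiscType → DiscType → ℝ
  | large, large, large => tightExcess i r large large large / 3
  | small, small, small => tightExcess i r small small small / 3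
  | small, large, small => 0
  | large, small, small => tightExcess i r large small small / 2
  | small, small, large => tightExcess i r large small small / 2
  | large, large, small => tightPotentialLLS i r
  | small, large, large => tightPotentialLLS i r
  | large, small, large => tightExcess i r large large small - 2 * tightPotentialLLS i r

theorem targetSum_excess (i : ℕ) (r : ℝ) (hr : 0 < r) :
    (targetCount i).1 * tightExcess i r large large large
      + (targetCount i).2.1 * tightExcess i r large large small
      + (targetCount i).2.2.1 * tightExcess i r large small small
      + (targetCount i).2.2.2 * tightExcess i r small small small = 0 := by
  have h1 : 0 < tightArea 1 1 1 := Real.sqrt_pos.2 (by positivity)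
  have h2 : 0 < tightArea 1 1 r := Real.sqrt_pos.2 (by positivity)
  have h3 : 0 < tightArea 1 r r := Real.sqrt_pos.2 (by positivity)
  have h4 : 0 < tightArea r r r := Real.sqrt_pos.2 (by positivity)
  have hA : targetSum i r tightArea ≠ 0 := by
    apply ne_of_gt
    unfold targetSum targetCount
    split <;> simp only <;> linarith
  have hd : targetDensity i r * targetSum i r tightArea = targetSum i r tightCov := by
    unfold targetDensity
    field_simp
  unfold targetSum at hd
  simp only [tightExcess, DiscType.radius]
  linarith

/-- The system is solvable, and it determines the potentials. -/
theorem isTightPotential_iff (i : ℕ) (hi : i ∈ Set.Icc 1 9) (r : ℝ) (hr : 0 < r)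
    (V : DiscType → DiscType → DiscType → ℝ) :
    IsTightPotential i r V ↔ V = tightPotential i r := by
  have hs := targetSum_excess i r hr
  obtain ⟨h1, h9⟩ := hi
  constructor
  · rintro ⟨a, b, c, d, e, f, g, h⟩
    have a1 := a small small large
    have a2 := a small large large
    funext x q y
    interval_cases i <;>
      simp only [largeCorona, smallCorona, targetCount] at f g h hs <;> norm_num at f g h hs <;>
      cases x <;> cases q <;> cases y <;>
      simp only [tightPotential, tightPotentialLLS] <;> linarith
  · rintro rfl
    refine ⟨?_, ?_, ?_, ?_, ?_, ?_, ?_, ?_⟩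
    · intro x q y
      cases x <;> cases q <;> cases y <;> rfl
    · simp only [tightPotential]; ring
    · simp only [tightPotential]; ring
    · simp only [tightPotential]; ring
    · simp only [tightPotential]; ring
    all_goals
      interval_cases i <;>
      simp only [largeCorona, smallCorona, targetCount] at hs ⊢ <;>
      norm_num [tightPotential, tightPotentialLLS] at hs ⊢ <;> linarith

/-! ### Packings and FM-triangulations -/

/-- A packing by discs of radii `1` and `r`: interior-disjoint discs, given by the set of their
centres and by their kinds (the kind of a point which is not a centre plays no role). -/
structure DiscPacking (r : ℝ) where
  centers : Set Plane
  kind : Plane → DiscType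
  disjoint : centers.PairwiseDisjoint fun c => Metric.ball c ((kind c).radius r)

namespace DiscPacking

variable {r : ℝ}

/-- The radius of the disc centred at `c`. -/
def rad (P : DiscPacking r) (c : Plane) : ℝ := (P.kind c).radius r

/-- Saturated: no further disc of radius `1` or `r` can be added. -/
def Saturated (P : DiscPacking r) : Prop :=
  ∀ (x : Plane) (t : DiscType),
    ∃ c ∈ P.centers, ¬ Disjoint (Metric.ball x (t.radius r)) (Metric.ball c (P.rad c))

/-- The (closed) cell of the disc centred at `c`: the points which are at least as close to this
disc as to any other one. -/
def cell (P : DiscPacking r) (c : Plane) : Set Plane :=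
  {x | ∀ c' ∈ P.centers, dist x c - P.rad c ≤ dist x c' - P.rad c'}

/-- `𝒯` (a set of triangles, each given by its three vertices) is an FM-triangulation of `P`: a
face-to-face triangulation of the plane whose vertices are the centres of the discs, and which is
dual to the cells, that is, the cells of the three discs of a triangle have a point in common.
(If more than three cells meet in a point, the dual polygon may be triangulated in any way.) -/
structure IsFMTriangulation (P : DiscPacking r) (𝒯 : Set (Finset Plane)) : Prop where
  card_eq : ∀ T ∈ 𝒯, T.card = 3
  nondegenerate : ∀ T ∈ 𝒯, AffineIndependent ℝ (fun c : T => (c : Plane))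
  subset_centers : ∀ T ∈ 𝒯, (T : Set Plane) ⊆ P.centers
  exists_mem : ∀ c ∈ P.centers, ∃ T ∈ 𝒯, c ∈ T
  cover : ⋃ T ∈ 𝒯, convexHull ℝ (T : Set Plane) = Set.univ
  face_to_face : ∀ T ∈ 𝒯, ∀ T' ∈ 𝒯,
    convexHull ℝ (T : Set Plane) ∩ convexHull ℝ (T' : Set Plane)
      = convexHull ℝ ((T : Set Plane) ∩ (T' : Set Plane))
  dual : ∀ T ∈ 𝒯, ∃ x, ∀ c ∈ T, x ∈ P.cell c

/-- The set of triangles of `𝒯` which contain the vertex `v`. -/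
def star (𝒯 : Set (Finset Plane)) (v : Plane) : Set (Finset Plane) := {T ∈ 𝒯 | v ∈ T}

/-- A disc is singular if it is small and surrounded by two large and three small discs, in this
cyclic order. -/
def IsSingular (P : DiscPacking r) (𝒯 : Set (Finset Plane)) (v : Plane) : Prop :=
  P.kind v = small ∧ ∃ w : Fin 5 → Plane, Function.Injective w ∧
    (∀ T : Finset Plane, T ∈ star 𝒯 v ↔ ∃ j, (T : Set Plane) = {v, w j, w (j + 1)}) ∧
    P.kind (w 0) = large ∧ P.kind (w 1) = large ∧
    P.kind (w 2) = small ∧ P.kind (w 3) = small ∧ P.kind (w 4) = small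

/-- The number of singular discs of a triangle. -/
def numSingular (P : DiscPacking r) (𝒯 : Set (Finset Plane)) (T : Finset Plane) : ℕ :=
  (T.filter fun w => P.IsSingular 𝒯 w).card

/-- The case `i = 5`, potential at `v` in a tight triangle of three small discs: half of the
excess at a singular vertex; the regular vertices share equally what remains of the excess. -/
def smallTriplePotential (P : DiscPacking r) (𝒯 : Set (Finset Plane)) (v : Plane)
    (T : Finset Plane) : ℝ :=
  if P.IsSingular 𝒯 v then tightExcess 5 r small small small / 2
  else (tightExcess 5 r small small small
      - P.numSingular 𝒯 T * (tightExcess 5 r small small small / 2)) / (3 - P.numSingular 𝒯 T)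

/-- The potential `U_v(T^*)` at `v` in the tight version of a triangle `T` with vertices `a`, `v`,
`b`. -/
def basePotential (i : ℕ) (P : DiscPacking r) (𝒯 : Set (Finset Plane)) (T : Finset Plane)
    (a v b : Plane) : ℝ :=
  if i = 5 ∧ P.kind a = small ∧ P.kind v = small ∧ P.kind b = small then
    P.smallTriplePotential 𝒯 v T
  else tightPotential i r (P.kind a) (P.kind v) (P.kind b)

/-- The vertex potential at `v` of a triangle `T` with vertices `a`, `v`, `b`. -/
def cornerPotential (i : ℕ) (P : DiscPacking r) (𝒯 : Set (Finset Plane)) (m : DiscType → ℝ)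
    (T : Finset Plane) (a v b : Plane) : ℝ :=
  P.basePotential i 𝒯 T a v b
    + m (P.kind v) *
      |EuclideanGeometry.angle a v b - tightAngle (P.rad a) (P.rad v) (P.rad b)|

/-- The vertex potential `U_v(T)`. The sum runs over the two orderings `(a, b)` of the other two
vertices of `T`, for which `cornerPotential` has the same value, see `vertexPotential_eq`. -/
def vertexPotential (i : ℕ) (P : DiscPacking r) (𝒯 : Set (Finset Plane)) (m : DiscType → ℝ)
    (v : Plane) (T : Finset Plane) : ℝ :=
  (∑ a ∈ T.erase v, ∑ b ∈ (T.erase v).erase a, P.cornerPotential i 𝒯 m T a v b) / 2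

theorem cornerPotential_comm (i : ℕ) (P : DiscPacking r) (𝒯 : Set (Finset Plane))
    (m : DiscType → ℝ) (T : Finset Plane) (a v b : Plane) :
    P.cornerPotential i 𝒯 m T a v b = P.cornerPotential i 𝒯 m T b v a := by
  have h1 : ∀ x q y, tightPotential i r x q y = tightPotential i r y q x := by
    intro x q y
    cases x <;> cases q <;> cases y <;> rfl
  have h2 : ∀ x y z : ℝ, tightAngle x y z = tightAngle z y x := by
    intro x y z
    unfold tightAngle
    congr 1
    ring
  unfold cornerPotential basePotential
  rw [EuclideanGeometry.angle_comm, h2, h1]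
  congr 1
  by_cases h : i = 5 ∧ P.kind a = small ∧ P.kind v = small ∧ P.kind b = small
  · have h' : i = 5 ∧ P.kind b = small ∧ P.kind v = small ∧ P.kind a = small :=
      ⟨h.1, h.2.2.2, h.2.2.1, h.2.1⟩
    rw [if_pos h, if_pos h']
  · have h' : ¬ (i = 5 ∧ P.kind b = small ∧ P.kind v = small ∧ P.kind a = small) :=
      fun k => h ⟨k.1, k.2.2.2, k.2.2.1, k.2.1⟩
    rw [if_neg h, if_neg h']

theorem vertexPotential_eq (i : ℕ) (P : DiscPacking r) (𝒯 : Set (Finset Plane))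
    (m : DiscType → ℝ) (v a b : Plane) (hva : v ≠ a) (hvb : v ≠ b) (hab : a ≠ b) :
    P.vertexPotential i 𝒯 m v {v, a, b} = P.cornerPotential i 𝒯 m {v, a, b} a v b := by
  have h : ({v, a, b} : Finset Plane).erase v = {a, b} := by
    rw [Finset.erase_insert]
    simp [hva, hvb]
  have ha : ({a, b} : Finset Plane).erase a = {b} := by
    rw [Finset.erase_insert]
    simp [hab]
  have hb : ({a, b} : Finset Plane).erase b = {a} := by
    rw [Finset.pair_comm, Finset.erase_insert]
    simp [hab.symm]
  unfold vertexPotential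
  rw [h, Finset.sum_pair hab, ha, hb, Finset.sum_singleton, Finset.sum_singleton,
    cornerPotential_comm i P 𝒯 m _ b v a]
  ring

end DiscPacking

/-- The tabulated lower bounds on `m_1` and `m_r`. -/
def mLowerBound (i : ℕ) (t : DiscType) : ℝ :=
  match i, t with
  | 1, small => 0.0005
  | 2, large => 0.16
  | 2, small => 0.087
  | 3, small => 0.00028
  | 4, small => 0.0021
  | 5, small => 0.048
  | 6, large => 0.0091
  | 6, small => 0.0021
  | 7, small => 0.0011
  | 8, small => 0.002
  | 9, small => 0.002058
  | _, _ => 0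

end DiscPack

end

/-! Saturation bounds the size of the triangles, and centres are uniformly separated, so only
finitely many triangles contain `v`. Since the triangulation is face-to-face and covers a
neighbourhood of `v`, these triangles form a cycle and their angles at `v` add up to `2π`
(`exists_cycle`).

Let `n₁`, `n₂`, `n₃` be the numbers of corners at `v` between two large discs, a large and a small
one, and two small ones. By the triangle inequality, the deviations from the tight angles `θ₁`,
`θ₂`, `θ₃` add up to at least `|2π - (n₁θ₁ + n₂θ₂ + n₃θ₃)|`. With `q` the kind of the disc at `v`,
the vertex sum is therefore at least `n₁V₁ + n₂V₂ + n₃V₃ + m_q |2π - (n₁θ₁ + n₂θ₂ + n₃θ₃)|`, which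
no longer depends on the geometry. Moreover `n₂` is even, because kinds change an even number of
times around a cycle.

It remains to show that this expression is nonnegative (`corona_nonneg`). A corner contributes `V +
m_q θ ≥ 0` when the absolute value is opened with the sign that favours many corners, so a large
number of corners of one kind already outweighs `2π m_q`. What is left is a finite box of triples,
decided in integers (`coronaCheck`) from enclosures of the radii, angles and excesses
(`radius_near`, `inputs_near`, `excess_near`). The only triple exempted from the check is the corona
of the target packing, where the potentials add up to exactly zero by the equations defining them
(`target_sum_eq_zero`).

For `i = 5` the exempted corona of a small disc is, up to rotation, that of a singular disc
(`exists_rotation`). There the modified potentials add up to zero, while at a regular disc the share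
of `E_rrr` is bounded below by zero. -/

namespace DiscPack

open DiscType

/-! ### Polar coordinates in the plane -/

/-- The unit vector of the plane with polar angle `θ`. -/
noncomputable def dir (θ : ℝ) : Plane := !₂[Real.cos θ, Real.sin θ]

theorem dir_add_int_mul_two_pi (θ : ℝ) (k : ℤ) : dir (θ + k * (2 * Real.pi)) = dir θ := by
  simp [dir, Real.cos_add_int_mul_two_pi, Real.sin_add_int_mul_two_pi]

/-- For `α < θ < β < α + π` all three sines are positive, so this exhibits `dir θ` as an interior
direction of the cone spanned by `dir α` and `dir β`. -/
theorem sin_smul_dir (α β θ : ℝ) :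
    Real.sin (β - α) • dir θ = Real.sin (β - θ) • dir α + Real.sin (θ - α) • dir β := by
  ext k
  fin_cases k <;> simp [dir, Real.sin_sub] <;> ring

theorem norm_dir (θ : ℝ) : ‖dir θ‖ = 1 := by
  simp [dir, EuclideanSpace.norm_eq]

theorem dir_ne_zero (θ : ℝ) : dir θ ≠ 0 := by
  intro h
  simpa [h] using norm_dir θ

theorem inner_dir (α β : ℝ) : inner ℝ (dir α) (dir β) = Real.cos (β - α) := by
  simp [dir, PiLp.inner_apply, Real.cos_sub]

theorem exists_eq_smul_dir {x : Plane} (hx : x ≠ 0) : ∃ ρ : ℝ, 0 < ρ ∧ ∃ θ, x = ρ • dir θ := by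
  have hz : (⟨x 0, x 1⟩ : ℂ) ≠ 0 := by
    intro h
    apply hx
    ext k
    fin_cases k
    · exact congrArg Complex.re h
    · exact congrArg Complex.im h
  refine ⟨‖(⟨x 0, x 1⟩ : ℂ)‖, norm_pos_iff.2 hz, Complex.arg ⟨x 0, x 1⟩, ?_⟩
  ext k
  fin_cases k
  · simp [dir, Complex.norm_mul_cos_arg]
  · simp [dir, Complex.norm_mul_sin_arg]

/-- A shift of `θ` by a multiple of `2π` lies in `[a, a + 2π)`. -/
theorem exists_shift_mem_Ico (a θ : ℝ) :
    ∃ k : ℤ, a ≤ θ + k * (2 * Real.pi) ∧ θ + k * (2 * Real.pi) < a + 2 * Real.pi := by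
  have h := toIcoMod_mem_Ico Real.two_pi_pos a θ
  rw [toIcoMod] at h
  refine ⟨-toIcoDiv Real.two_pi_pos a θ, ?_, ?_⟩
  · have := h.1
    push_cast
    simp only [zsmul_eq_mul] at this
    linarith
  · have := h.2
    push_cast
    simp only [zsmul_eq_mul] at this
    linarith

theorem eq_add_int_of_dir_eq_smul {α β c : ℝ} (hc : 0 < c) (h : dir α = c • dir β) :
    ∃ k : ℤ, α = β + k * (2 * Real.pi) := by
  have hc1 : c = 1 := by
    have := congrArg norm h
    rw [norm_smul, norm_dir, norm_dir, Real.norm_of_nonneg hc.le] at this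
    linarith
  subst hc1
  rw [one_smul] at h
  have h1 : Real.cos (β - α) = 1 := by
    rw [← inner_dir, h, real_inner_self_eq_norm_sq, norm_dir]
    norm_num
  obtain ⟨k, hk⟩ := (Real.cos_eq_one_iff _).1 h1
  exact ⟨-k, by push_cast; linarith⟩

theorem angle_of_polar {a v b : Plane} {ρ σ α β : ℝ} (hρ : 0 < ρ) (hσ : 0 < σ)
    (ha : a - v = ρ • dir α) (hb : b - v = σ • dir β) (h1 : α ≤ β) (h2 : β ≤ α + Real.pi) :
    EuclideanGeometry.angle a v b = β - α := by
  unfold EuclideanGeometry.angle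
  rw [vsub_eq_sub, vsub_eq_sub, ha, hb, InnerProductGeometry.angle_smul_left_of_pos _ _ hρ,
    InnerProductGeometry.angle_smul_right_of_pos _ _ hσ, InnerProductGeometry.angle, inner_dir,
    norm_dir, norm_dir, mul_one, div_one, Real.arccos_cos (by linarith) (by linarith)]

namespace DiscPacking

variable {r : ℝ} {P : DiscPacking r} {𝒯 : Set (Finset Plane)} {v : Plane}

/-! ### Finiteness -/

/-- Nondegeneracy enters the proof only in this form: the two edge vectors at `v` are linearly
independent. -/
theorem IsFMTriangulation.smul_add_smul_eq_zero (h : P.IsFMTriangulation 𝒯) {a b : Plane}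
    (hT : {v, a, b} ∈ 𝒯) {s t : ℝ} (hst : s • (a - v) + t • (b - v) = 0) : s = 0 ∧ t = 0 := by
  have hc := h.card_eq _ hT
  have hva : v ≠ a := by
    rintro rfl
    have := Finset.card_le_two (a := v) (b := b)
    rw [Finset.insert_eq_of_mem (by simp)] at hc
    omega
  have hvb : v ≠ b := by
    rintro rfl
    have := Finset.card_le_two (a := a) (b := v)
    rw [Finset.insert_eq_of_mem (by simp)] at hc
    omega
  have hab : a ≠ b := by
    rintro rfl
    have := Finset.card_le_two (a := v) (b := a)
    rw [Finset.pair_eq_singleton] at hc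
    omega
  have hi := h.nondegenerate _ hT
  rw [affineIndependent_iff] at hi
  -- The weights at `v`, `a`, `b` have sum zero, so affine independence forces them to vanish.
  let w : Plane → ℝ := fun x => if x = v then -(s + t) else if x = a then s else t
  have hwv : w v = -(s + t) := by simp [w]
  have hwa : w a = s := by simp [w, hva.symm]
  have hwb : w b = t := by simp [w, hvb.symm, hab.symm]
  have hsum : ∀ f : Plane → Plane, ∑ e : ({v, a, b} : Finset Plane), f e = f v + f a + f b := by
    intro f
    rw [Finset.sum_coe_sort ({v, a, b} : Finset Plane) f, Finset.sum_insert (by simp [hva, hvb]),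
      Finset.sum_pair hab, add_assoc]
  have hsum' : ∀ f : Plane → ℝ, ∑ e : ({v, a, b} : Finset Plane), f e = f v + f a + f b := by
    intro f
    rw [Finset.sum_coe_sort ({v, a, b} : Finset Plane) f, Finset.sum_insert (by simp [hva, hvb]),
      Finset.sum_pair hab, add_assoc]
  have h0 := hi Finset.univ (fun e => w e) (by rw [hsum' w, hwv, hwa, hwb]; ring) (by
    rw [hsum fun e => w e • e, hwv, hwa, hwb, ← hst]
    module)
  have ha := h0 ⟨a, by simp⟩ (Finset.mem_univ _)
  have hb := h0 ⟨b, by simp⟩ (Finset.mem_univ _)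
  exact ⟨hwa ▸ ha, hwb ▸ hb⟩

theorem IsFMTriangulation.exists_eq (h : P.IsFMTriangulation 𝒯) {T : Finset Plane}
    (hT : T ∈ star 𝒯 v) : ∃ a b, T = {v, a, b} ∧ v ≠ a ∧ v ≠ b ∧ a ≠ b := by
  obtain ⟨hT, hv⟩ := hT
  have hc : (T.erase v).card = 2 := by rw [Finset.card_erase_of_mem hv, h.card_eq _ hT]
  obtain ⟨a, b, hab, he⟩ := Finset.card_eq_two.1 hc
  have ha : a ∈ T.erase v := by simp [he]
  have hb : b ∈ T.erase v := by simp [he]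
  exact ⟨a, b, by rw [← he, Finset.insert_erase hv], (Finset.ne_of_mem_erase ha).symm,
    (Finset.ne_of_mem_erase hb).symm, hab⟩

theorem radius_pos (hr : 0 < r) (c : Plane) : 0 < P.rad c := by
  unfold rad
  cases P.kind c <;> simp [DiscType.radius, hr]

theorem le_dist_of_ne (hr : 0 < r) {c c' : Plane} (hc : c ∈ P.centers) (hc' : c' ∈ P.centers)
    (hne : c ≠ c') : P.rad c + P.rad c' ≤ dist c c' :=
  (disjoint_ball_ball_iff (radius_pos hr c) (radius_pos hr c')).1 (P.disjoint hc hc' hne)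

/-- All radii are at least `min 1 r`, so the centres form a uniformly separated, hence closed and
discrete, set. -/
theorem finite_centers_inter (hr : 0 < r) {K : Set Plane} (hK : Bornology.IsBounded K) :
    (K ∩ P.centers).Finite := by
  have hmin : ∀ c, min 1 r ≤ P.rad c := by
    intro c
    unfold rad
    cases P.kind c <;> simp [DiscType.radius]
  have h0 : 0 < min 1 r := lt_min one_pos hr
  have hd : P.centers.Pairwise fun x y => min 1 r ≤ dist x y := by
    intro x hx y hy hxy
    have := le_dist_of_ne hr hx hy hxy
    linarith [hmin x, hmin y]
  have hdisc : DiscreteTopology P.centers :=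
    DiscreteTopology.of_forall_le_dist h0 fun x y hxy =>
      hd x.2 y.2 fun h => hxy (Subtype.ext h)
  exact Metric.finite_isBounded_inter_isClosed hdisc.isDiscrete hK
    (Metric.isClosed_of_pairwise_le_dist h0 hd)

/-- No small disc fits at the common point `x` of the three cells, so some disc is at distance less
than `r` from `x`. By definition of the cells, so are the three discs of the triangle. Both radii
are at most `1 + r`, whether or not `r < 1`. -/
theorem IsFMTriangulation.dist_lt (h : P.IsFMTriangulation 𝒯) (hP : P.Saturated) (hr : 0 < r)
    {T : Finset Plane} (hT : T ∈ 𝒯) {a b : Plane} (ha : a ∈ T) (hb : b ∈ T) :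
    dist a b < 2 * (1 + r + r) := by
  obtain ⟨x, hx⟩ := h.dual T hT
  obtain ⟨c, hc, hn⟩ := hP x small
  have h1 : dist x c < r + P.rad c := by
    by_contra hle
    exact hn ((disjoint_ball_ball_iff hr (radius_pos hr c)).2 (not_lt.1 hle))
  have hrad : ∀ c, P.rad c ≤ 1 + r := by
    intro c
    unfold rad
    cases P.kind c <;> simp [DiscType.radius, hr.le]
  have key : ∀ a ∈ T, dist x a < 1 + r + r := by
    intro a ha
    have := hx a ha c hc
    linarith [hrad a]
  have := dist_triangle_left a b x
  linarith [key a ha, key b hb]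

/-- Finiteness is needed beyond the star of `v`: it makes the union of the nearby triangles that
miss `v` closed. -/
theorem IsFMTriangulation.finite_near (h : P.IsFMTriangulation 𝒯) (hP : P.Saturated)
    (hr : 0 < r) (v : Plane) (R : ℝ) : {T ∈ 𝒯 | ∃ a ∈ T, dist a v ≤ R}.Finite := by
  have hf := finite_centers_inter (P := P) hr
    (Metric.isBounded_closedBall (x := v) (r := R + 2 * (1 + r + r)))
  refine (hf.toFinset.powerset.finite_toSet).subset ?_
  rintro T ⟨hT, a, ha, hav⟩
  simp only [Finset.coe_powerset, Set.mem_preimage, Set.mem_powerset_iff, Set.Finite.coe_toFinset]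
  intro b hb
  refine ⟨?_, h.subset_centers T hT hb⟩
  rw [Metric.mem_closedBall]
  have := dist_triangle b a v
  have := h.dist_lt hP hr hT hb ha
  linarith

theorem IsFMTriangulation.star_finite (h : P.IsFMTriangulation 𝒯) (hP : P.Saturated)
    (hr : 0 < r) (v : Plane) : (star 𝒯 v).Finite := by
  refine (h.finite_near hP hr v 0).subset ?_
  rintro T ⟨hT, hv⟩
  exact ⟨hT, v, hv, by simp⟩

/-! ### Triangles around a vertex -/

/-- Compare `T` with a triangle `T₀` that has `v` as a vertex. If `v` were not a vertex of `T`, the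
face-to-face condition would put `v` on the edge of `T₀` opposite to it, and `T₀` would be
degenerate. -/
theorem IsFMTriangulation.mem_of_mem_convexHull (h : P.IsFMTriangulation 𝒯)
    (hv : v ∈ P.centers) {T : Finset Plane} (hT : T ∈ 𝒯)
    (hvT : v ∈ convexHull ℝ (T : Set Plane)) : v ∈ T := by
  obtain ⟨T₀, hT₀, hv₀⟩ := h.exists_mem v hv
  have h1 : v ∈ convexHull ℝ ((T : Set Plane) ∩ (T₀ : Set Plane)) := by
    rw [← h.face_to_face T hT T₀ hT₀]
    exact ⟨hvT, subset_convexHull ℝ _ hv₀⟩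
  by_contra hn
  obtain ⟨a, b, rfl, hva, hvb, hab⟩ := h.exists_eq ⟨hT₀, hv₀⟩
  have h2 : v ∈ convexHull ℝ (({a, b} : Finset Plane) : Set Plane) := by
    refine convexHull_mono ?_ h1
    rintro x ⟨hx, hx'⟩
    simp only [Finset.coe_insert, Finset.coe_singleton, Set.mem_insert_iff,
      Set.mem_singleton_iff] at hx' ⊢
    rcases hx' with rfl | hx'
    · exact absurd hx hn
    · exact hx'
  rw [Finset.mem_convexHull'] at h2
  obtain ⟨w, -, hw1, hw2⟩ := h2
  rw [Finset.sum_pair hab] at hw1 hw2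
  have h3 : w a • (a - v) + w b • (b - v) = 0 := by
    have : w a • (a - v) + w b • (b - v) = (w a • a + w b • b) - (w a + w b) • v := by module
    rw [this, hw1, hw2, one_smul, sub_self]
  obtain ⟨ha, hb⟩ := h.smul_add_smul_eq_zero hT₀ h3
  rw [ha, hb] at hw1
  norm_num at hw1

/-- The triangles at `v` cover a neighbourhood of `v`. -/
theorem IsFMTriangulation.exists_ball_subset (h : P.IsFMTriangulation 𝒯) (hP : P.Saturated)
    (hr : 0 < r) (hv : v ∈ P.centers) : ∃ ε > 0, ∀ x, dist x v < ε →
      ∃ T ∈ star 𝒯 v, x ∈ convexHull ℝ (T : Set Plane) := by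
  -- A triangle containing a point within distance 1 of `v` has all its vertices within this radius.
  -- Those without vertex `v` are finitely many, and their closed union avoids `v`, hence a whole
  -- ball around `v`.
  have hfin := h.finite_near hP hr v (1 + 2 * (1 + r + r))
  set S := {T ∈ 𝒯 | ∃ a ∈ T, dist a v ≤ 1 + 2 * (1 + r + r)} with hS
  have hcl : IsClosed (⋃ T ∈ S \ star 𝒯 v, convexHull ℝ (T : Set Plane)) :=
    (hfin.subset Set.sdiff_subset).isClosed_biUnion fun T _ =>
      (T.finite_toSet.isCompact_convexHull ℝ).isClosed
  have hvn : v ∈ (⋃ T ∈ S \ star 𝒯 v, convexHull ℝ (T : Set Plane))ᶜ := by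
    simp only [Set.mem_compl_iff, Set.mem_iUnion, not_exists]
    intro T hT hvT
    exact hT.2 ⟨hT.1.1, h.mem_of_mem_convexHull hv hT.1.1 hvT⟩
  obtain ⟨ε, hε, hsub⟩ := Metric.isOpen_iff.1 hcl.isOpen_compl v hvn
  refine ⟨min ε 1, lt_min hε one_pos, fun x hx => ?_⟩
  have hxu : x ∈ ⋃ T ∈ 𝒯, convexHull ℝ (T : Set Plane) := by rw [h.cover]; trivial
  simp only [Set.mem_iUnion] at hxu
  obtain ⟨T, hT, hxT⟩ := hxu
  refine ⟨T, ?_, hxT⟩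
  by_contra hn
  have hTS : T ∈ S := by
    obtain ⟨a, ha⟩ : T.Nonempty := by
      rw [← Finset.card_pos, h.card_eq T hT]; norm_num
    refine ⟨hT, a, ha, ?_⟩
    have h1 : dist x a ≤ 2 * (1 + r + r) := by
      have hs : (T : Set Plane) ⊆ Metric.closedBall a (2 * (1 + r + r)) := fun b hb =>
        (h.dist_lt hP hr hT hb ha).le
      exact (convexHull_min hs (convex_closedBall _ _)) hxT
    have := dist_triangle_left a v x
    have := lt_of_lt_of_le hx (min_le_right _ _)
    linarith
  refine hsub (Metric.mem_ball.2 (lt_of_lt_of_le hx (min_le_left _ _))) ?_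
  simp only [Set.mem_iUnion]
  exact ⟨T, ⟨hTS, hn⟩, hxT⟩

theorem exists_smul_of_mem_convexHull {S : Set Plane} {p b : Plane} (hS : S ⊆ {v, b})
    (hp : p ∈ convexHull ℝ S) : ∃ μ : ℝ, p - v = μ • (b - v) := by
  have h1 := convexHull_mono hS hp
  rw [convexHull_pair, segment_eq_image'] at h1
  obtain ⟨μ, -, rfl⟩ := h1
  exact ⟨μ, by simp⟩

theorem mem_convexHull_triple {a b : Plane} {s t : ℝ} (hs : 0 ≤ s) (ht : 0 ≤ t) (hst : s + t ≤ 1) :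
    v + (s • (a - v) + t • (b - v)) ∈ convexHull ℝ (({v, a, b} : Finset Plane) : Set Plane) := by
  have hc := convex_convexHull ℝ (({v, a, b} : Finset Plane) : Set Plane)
  have hm : ∀ x ∈ ({v, a, b} : Finset Plane),
      x ∈ convexHull ℝ (({v, a, b} : Finset Plane) : Set Plane) :=
    fun x hx => subset_convexHull ℝ _ hx
  have := hc.sum_mem (t := Finset.univ) (w := ![1 - s - t, s, t]) (z := ![v, a, b])
    (by intro k _; fin_cases k <;> simp <;> linarith)
    (by simp only [Fin.sum_univ_three, Matrix.cons_val]; ring)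
    (by intro k _; fin_cases k <;> exact hm _ (by simp))
  simp only [Fin.sum_univ_three, Matrix.cons_val] at this
  convert this using 1
  module

/-- Move `c` towards `v` until the point `p` lies in both triangles. If `a` were not a common
vertex, the intersection of the triangles would lie on the line through `v` and `b`, but `p - v` has
a positive component along `a - v`. Allowing `t = 0` also covers a neighbour on the ray of `a`. -/
theorem IsFMTriangulation.mem_of_cone (h : P.IsFMTriangulation 𝒯) {a b c d : Plane}
    (hT : {v, a, b} ∈ 𝒯) (hT' : {v, c, d} ∈ 𝒯) {s t : ℝ} (hs : 0 < s) (ht : 0 ≤ t)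
    (hc : c - v = s • (a - v) + t • (b - v)) : a ∈ ({v, c, d} : Finset Plane) := by
  by_contra hn
  -- This factor makes both `lam` and `lam * (s + t)` at most 1, so `p` lies in both triangles.
  have hlam : 0 < 1 / (1 + s + t) := by positivity
  set lam := 1 / (1 + s + t) with hl
  have hlam1 : lam * (1 + s + t) = 1 := by rw [hl]; field_simp
  set p := v + lam • (c - v) with hp
  have hp1 : p ∈ convexHull ℝ (({v, a, b} : Finset Plane) : Set Plane) := by
    have := mem_convexHull_triple (v := v) (a := a) (b := b) (s := lam * s) (t := lam * t)
      (by positivity) (by positivity) (by nlinarith)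
    rw [hp, hc, smul_add, smul_smul, smul_smul]
    exact this
  have hp2 : p ∈ convexHull ℝ (({v, c, d} : Finset Plane) : Set Plane) := by
    have := mem_convexHull_triple (v := v) (a := c) (b := d) (s := lam) (t := 0)
      hlam.le le_rfl (by nlinarith)
    rwa [zero_smul, add_zero] at this
  have hp3 := h.face_to_face _ hT _ hT' ▸ Set.mem_inter hp1 hp2
  obtain ⟨μ, hμ⟩ := exists_smul_of_mem_convexHull (v := v) (b := b) (by
    rintro x ⟨hx, hx'⟩
    simp only [Finset.coe_insert, Finset.coe_singleton, Set.mem_insert_iff,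
      Set.mem_singleton_iff] at hx ⊢
    rcases hx with hx | rfl | hx
    · exact Or.inl hx
    · exact absurd hx' hn
    · exact Or.inr hx) hp3
  have h0 : (lam * s) • (a - v) + (lam * t - μ) • (b - v) = 0 := by
    rw [sub_smul, ← hμ, hp, hc]
    module
  have := (h.smul_add_smul_eq_zero hT h0).1
  have : 0 < lam * s := by positivity
  linarith

/-- A neighbour of `v` does not lie in the interior of the cone of a triangle at `v`. -/
theorem IsFMTriangulation.not_mem_cone (h : P.IsFMTriangulation 𝒯) {a b c d : Plane}
    (hT : {v, a, b} ∈ 𝒯) (hT' : {v, c, d} ∈ 𝒯) {s t : ℝ} (hs : 0 < s) (ht : 0 < t) :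
    c - v ≠ s • (a - v) + t • (b - v) := by
  intro hc
  have ha := h.mem_of_cone hT hT' hs ht.le hc
  have hb := h.mem_of_cone (a := b) (b := a) (by rwa [Finset.pair_comm]) hT' ht hs.le
    (by rw [hc, add_comm])
  -- Having three vertices each, the two triangles coincide, so `c` is `v`, `a` or `b`. Each
  -- contradicts the positivity of `s` and `t`.
  have hsub : ({v, a, b} : Finset Plane) ⊆ {v, c, d} := by
    intro x hx
    simp only [Finset.mem_insert, Finset.mem_singleton] at hx
    rcases hx with rfl | rfl | rfl
    · simp
    · exact ha
    · exact hb
  have heq := Finset.eq_of_subset_of_card_le hsub (by rw [h.card_eq _ hT, h.card_eq _ hT'])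
  have hcm : c ∈ ({v, a, b} : Finset Plane) := by rw [heq]; simp
  simp only [Finset.mem_insert, Finset.mem_singleton] at hcm
  rcases hcm with rfl | rfl | rfl
  · rw [sub_self] at hc
    have := (h.smul_add_smul_eq_zero hT hc.symm).1
    linarith
  · have h0 : (s - 1) • (c - v) + t • (b - v) = 0 := by
      rw [sub_smul, one_smul, sub_add_eq_add_sub, ← hc, sub_self]
    have := (h.smul_add_smul_eq_zero hT h0).2
    linarith
  · have h0 : s • (a - v) + (t - 1) • (c - v) = 0 := by
      rw [sub_smul, one_smul, ← add_sub_assoc, ← hc, sub_self]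
    have := (h.smul_add_smul_eq_zero hT h0).1
    linarith

/-- Neighbours of `v` in the same direction are equal. -/
theorem IsFMTriangulation.eq_of_sameRay (h : P.IsFMTriangulation 𝒯) {a b c d : Plane}
    (hT : {v, a, b} ∈ 𝒯) (hT' : {v, c, d} ∈ 𝒯) {s : ℝ} (hs : 0 < s)
    (hc : c - v = s • (a - v)) : c = a := by
  have ha := h.mem_of_cone hT hT' hs le_rfl (by rw [hc, zero_smul, add_zero])
  simp only [Finset.mem_insert, Finset.mem_singleton] at ha
  rcases ha with rfl | rfl | rfl
  · have h0 : (1 : ℝ) • (a - a) + (0 : ℝ) • (b - a) = 0 := by simp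
    have := (h.smul_add_smul_eq_zero hT h0).1
    norm_num at this
  · rfl
  · have h0 : (1 : ℝ) • (c - v) + (-s) • (a - v) = 0 := by rw [hc]; module
    have := (h.smul_add_smul_eq_zero hT' h0).1
    norm_num at this

end DiscPacking

/-! ### Enumeration of a periodic set of angles -/

/-- A nonempty `p`-periodic set of reals which is finite modulo `p` can be enumerated
increasingly. -/
theorem exists_strictMono_enumeration {L : Set ℝ} {p : ℝ} (hp : 0 < p)
    (hper : ∀ θ ∈ L, ∀ k : ℤ, θ + k * p ∈ L) (hfin : (L ∩ Set.Ico 0 p).Finite)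
    (hne : L.Nonempty) :
    ∃ n : ℕ, 0 < n ∧ ∃ Φ : ℤ → ℝ, StrictMono Φ ∧ Set.range Φ = L ∧
      ∀ z k, Φ (z + k * n) = Φ z + k * p := by
  have hshift : ∀ θ ∈ L, ∃ k : ℤ, θ + k * p ∈ L ∩ Set.Ico 0 p := by
    intro θ hθ
    have h := toIcoMod_mem_Ico hp 0 θ
    rw [toIcoMod, zero_add] at h
    refine ⟨-toIcoDiv hp 0 θ, hper θ hθ _, ?_⟩
    convert h using 1
    simp only [zsmul_eq_mul]
    push_cast
    ring
  set S := hfin.toFinset with hS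
  have hmem : ∀ x, x ∈ S ↔ x ∈ L ∧ 0 ≤ x ∧ x < p := by
    intro x
    simp [hS]
  obtain ⟨n, hn⟩ : ∃ n, S.card = n := ⟨_, rfl⟩
  have hpos : 0 < n := by
    obtain ⟨θ, hθ⟩ := hne
    obtain ⟨k, hk⟩ := hshift θ hθ
    rw [← hn, Finset.card_pos]
    exact ⟨_, (hmem _).2 hk⟩
  let e := S.orderEmbOfFin hn
  have he : ∀ i, e i ∈ L ∧ 0 ≤ e i ∧ e i < p := fun i =>
    (hmem _).1 (Finset.orderEmbOfFin_mem S hn i)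
  have hn0 : (0 : ℤ) < n := by exact_mod_cast hpos
  have hlt : ∀ z : ℤ, (z % n).toNat < n := fun z => by
    have := Int.emod_lt_of_pos z hn0
    have := Int.emod_nonneg z hn0.ne'
    omega
  -- The remainder selects one of the `n` sorted representatives in `[0, p)`, the quotient counts
  -- the periods.
  let Φ : ℤ → ℝ := fun z => e ⟨(z % n).toNat, hlt z⟩ + (z / n : ℤ) * p
  have hΦ : ∀ (i : Fin n) (k : ℤ), Φ (i + k * n) = e i + k * p := by
    intro i k
    have h1 : ((i : ℤ) + k * n) % n = i := by
      rw [Int.add_mul_emod_self_right]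
      exact Int.emod_eq_of_lt (by omega) (by have := i.2; omega)
    have h2 : ((i : ℤ) + k * n) / n = k := by
      rw [Int.add_mul_ediv_right _ _ hn0.ne',
        Int.ediv_eq_zero_of_lt (by omega) (by have := i.2; omega), zero_add]
    simp only [Φ, h1, h2, Int.toNat_natCast]
  have hrep : ∀ z : ℤ, ∃ (i : Fin n) (k : ℤ), z = i + k * n := by
    intro z
    refine ⟨⟨(z % n).toNat, hlt z⟩, z / n, ?_⟩
    have := Int.emod_nonneg z hn0.ne'
    simp only [Int.toNat_of_nonneg this]
    linarith [Int.emod_add_mul_ediv z n]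
  refine ⟨n, hpos, Φ, strictMono_int_of_lt_succ fun z => ?_, ?_, ?_⟩
  · obtain ⟨i, k, rfl⟩ := hrep z
    by_cases hi : (i : ℕ) + 1 < n
    · have := hΦ ⟨i + 1, hi⟩ k
      have h2 : ((i : ℤ) + k * n + 1) = ((⟨i + 1, hi⟩ : Fin n) : ℕ) + k * n := by
        push_cast
        ring
      rw [h2, this, hΦ]
      have : e i < e ⟨i + 1, hi⟩ := e.strictMono (by simp [Fin.lt_def])
      linarith
    · have h2 : ((i : ℤ) + k * n + 1) = ((⟨0, hpos⟩ : Fin n) : ℕ) + (k + 1 : ℤ) * n := by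
        have := i.2
        have : (n : ℤ) = i + 1 := by omega
        push_cast
        linear_combination -this
      rw [h2, hΦ, hΦ]
      have := (he i).2.2
      have := (he ⟨0, hpos⟩).2.1
      push_cast
      linarith
  · ext θ
    constructor
    · rintro ⟨z, rfl⟩
      exact hper _ (he _).1 _
    · intro hθ
      obtain ⟨k, hk⟩ := hshift θ hθ
      have : θ + k * p ∈ Set.range e := by
        rw [Finset.range_orderEmbOfFin]
        exact (hmem _).2 hk
      obtain ⟨i, hi⟩ := this
      refine ⟨i + (-k) * n, ?_⟩
      rw [hΦ, hi]
      push_cast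
      ring
  · intro z k
    obtain ⟨i, l, rfl⟩ := hrep z
    rw [add_assoc, ← add_mul, hΦ, hΦ]
    push_cast
    ring

namespace DiscPacking

variable {r : ℝ} {P : DiscPacking r} {𝒯 : Set (Finset Plane)} {v : Plane}

/-! ### The cycle of triangles at a vertex -/

/-- The (real) polar angles of the neighbours of `v`, seen from `v`. -/
def polarAngles (𝒯 : Set (Finset Plane)) (v : Plane) : Set ℝ :=
  {θ | ∃ a b : Plane, {v, a, b} ∈ 𝒯 ∧ ∃ ρ : ℝ, 0 < ρ ∧ a - v = ρ • dir θ}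

theorem add_mem_polarAngles {θ : ℝ} (hθ : θ ∈ polarAngles 𝒯 v) (k : ℤ) :
    θ + k * (2 * Real.pi) ∈ polarAngles 𝒯 v := by
  obtain ⟨a, b, hT, ρ, hρ, ha⟩ := hθ
  exact ⟨a, b, hT, ρ, hρ, by rw [dir_add_int_mul_two_pi, ha]⟩

/-- Each of the finitely many neighbours has at most one polar angle in `[0, 2π)`. -/
theorem finite_polarAngles (hfin : (star 𝒯 v).Finite) :
    (polarAngles 𝒯 v ∩ Set.Ico 0 (2 * Real.pi)).Finite := by
  have hN : (⋃ T ∈ star 𝒯 v, (T : Set Plane)).Finite :=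
    hfin.biUnion fun T _ => T.finite_toSet
  refine (hN.biUnion (t := fun a => {θ | (∃ ρ : ℝ, 0 < ρ ∧ a - v = ρ • dir θ) ∧
    θ ∈ Set.Ico 0 (2 * Real.pi)}) fun a _ => Set.Subsingleton.finite ?_).subset ?_
  · rintro α ⟨⟨ρ, hρ, h1⟩, h2, h3⟩ β ⟨⟨σ, hσ, h4⟩, h5, h6⟩
    obtain ⟨k, hk⟩ := eq_add_int_of_dir_eq_smul (α := α) (β := β) (c := ρ⁻¹ * σ) (by positivity)
      (by rw [mul_smul, ← h4, h1, smul_smul, inv_mul_cancel₀ hρ.ne', one_smul])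
    have hpi := Real.two_pi_pos
    have h7 : (-1 : ℝ) < k := by by_contra hh; nlinarith
    have h8 : (k : ℝ) < 1 := by by_contra hh; nlinarith
    have h9 : k = 0 := by
      have : (-1 : ℤ) < k := by exact_mod_cast h7
      have : k < 1 := by exact_mod_cast h8
      omega
    rw [hk, h9]
    simp
  · rintro θ ⟨⟨a, b, hT, h⟩, hθ⟩
    simp only [Set.mem_iUnion]
    exact ⟨a, ⟨_, ⟨hT, by simp⟩, by simp⟩, h, hθ⟩

theorem IsFMTriangulation.ne_of_mem (h : P.IsFMTriangulation 𝒯) {a b : Plane}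
    (hT : {v, a, b} ∈ 𝒯) : a ≠ v ∧ b ≠ v := by
  constructor
  · rintro rfl
    have := (h.smul_add_smul_eq_zero (s := 1) (t := 0) hT (by simp)).1
    norm_num at this
  · rintro rfl
    have := (h.smul_add_smul_eq_zero (s := 0) (t := 1) hT (by simp)).2
    norm_num at this

/-- The polar angles of the two other vertices of a triangle at `v`, ordered counterclockwise. -/
theorem IsFMTriangulation.exists_polar (h : P.IsFMTriangulation 𝒯) {T : Finset Plane}
    (hT : T ∈ star 𝒯 v) : ∃ a b, T = {v, a, b} ∧ ∃ ρ σ α β : ℝ, 0 < ρ ∧ 0 < σ ∧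
      a - v = ρ • dir α ∧ b - v = σ • dir β ∧ α < β ∧ β < α + Real.pi := by
  obtain ⟨a, b, rfl, hva, hvb, hab⟩ := h.exists_eq hT
  obtain ⟨ρ, hρ, α, ha⟩ := exists_eq_smul_dir (sub_ne_zero.2 hva.symm)
  obtain ⟨σ, hσ, β₀, hb₀⟩ := exists_eq_smul_dir (sub_ne_zero.2 hvb.symm)
  obtain ⟨k, hk1, hk2⟩ := exists_shift_mem_Ico α β₀
  have hb : b - v = σ • dir (β₀ + k * (2 * Real.pi)) := by rw [dir_add_int_mul_two_pi, hb₀]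
  set β := β₀ + k * (2 * Real.pi)
  -- If the sine vanished, the two edge vectors would be parallel. This excludes `β = α` and `β = α
  -- + π`.
  have hsin : Real.sin (β - α) ≠ 0 := by
    intro h0
    have h4 : dir β = Real.cos (β - α) • dir α := by
      have h1 := Real.cos_add (β - α) α
      have h2 := Real.sin_add (β - α) α
      rw [sub_add_cancel, h0] at h1 h2
      ext j
      fin_cases j <;> simp [dir] <;> linarith
    have h5 : (σ * Real.cos (β - α)) • (a - v) + (-ρ) • (b - v) = 0 := by
      rw [ha, hb, h4]
      module
    have := (h.smul_add_smul_eq_zero hT.1 h5).2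
    linarith
  have hβ1 : β ≠ α := by rintro h0; rw [h0, sub_self] at hsin; simp at hsin
  have hβ2 : β ≠ α + Real.pi := by rintro h0; rw [h0, add_sub_cancel_left] at hsin; simp at hsin
  rcases lt_or_gt_of_ne hβ2 with h3 | h3
  · exact ⟨a, b, rfl, ρ, σ, α, β, hρ, hσ, ha, hb, lt_of_le_of_ne hk1 hβ1.symm, h3⟩
  -- Here the counterclockwise turn from `a` to `b` exceeds `π`: exchange the two and turn `β` back
  -- by `2π`.
  · refine ⟨b, a, by rw [Finset.pair_comm], σ, ρ, β + (-1 : ℤ) * (2 * Real.pi), α, hσ, hρ, ?_, ha,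
      ?_, ?_⟩
    · rw [dir_add_int_mul_two_pi, hb]
    · push_cast
      linarith
    · push_cast
      linarith

/-- By `sin_smul_dir`, a neighbour at angle `θ` would lie in the interior of the cone of the
triangle, which `not_mem_cone` forbids. -/
theorem IsFMTriangulation.not_mem_polarAngles (h : P.IsFMTriangulation 𝒯) {a b : Plane}
    {ρ σ α β θ : ℝ} (hT : {v, a, b} ∈ 𝒯) (hρ : 0 < ρ) (hσ : 0 < σ)
    (ha : a - v = ρ • dir α) (hb : b - v = σ • dir β) (hβ : β < α + Real.pi)
    (h1 : α < θ) (h2 : θ < β) : θ ∉ polarAngles 𝒯 v := by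
  rintro ⟨c, d, hT', τ, hτ, hc⟩
  have s1 : 0 < Real.sin (β - α) := Real.sin_pos_of_pos_of_lt_pi (by linarith) (by linarith)
  have s2 : 0 < Real.sin (β - θ) := Real.sin_pos_of_pos_of_lt_pi (by linarith) (by linarith)
  have s3 : 0 < Real.sin (θ - α) := Real.sin_pos_of_pos_of_lt_pi (by linarith) (by linarith)
  refine h.not_mem_cone hT hT' (s := τ * (Real.sin (β - α))⁻¹ * Real.sin (β - θ) * ρ⁻¹)
    (t := τ * (Real.sin (β - α))⁻¹ * Real.sin (θ - α) * σ⁻¹) (by positivity) (by positivity) ?_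
  have e : dir θ =
      (Real.sin (β - α))⁻¹ • (Real.sin (β - θ) • dir α + Real.sin (θ - α) • dir β) := by
    rw [← sin_smul_dir, smul_smul, inv_mul_cancel₀ s1.ne', one_smul]
  rw [hc, e, ha, hb]
  simp only [smul_add, smul_smul]
  congr 2 <;> field_simp

/-- A short step from `v` in direction `ψ` ends in a triangle at `v`, and barycentric coordinates
give `dir ψ` as a nonnegative combination of the two edge directions. A zero coefficient would make
`ψ` the angle of a neighbour. -/
theorem IsFMTriangulation.exists_polar_around (h : P.IsFMTriangulation 𝒯) (hP : P.Saturated)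
    (hr : 0 < r) (hv : v ∈ P.centers) {ψ : ℝ} (hψ : ψ ∉ polarAngles 𝒯 v) :
    ∃ a b : Plane, {v, a, b} ∈ 𝒯 ∧ ∃ ρ σ α β : ℝ, 0 < ρ ∧ 0 < σ ∧
      a - v = ρ • dir α ∧ b - v = σ • dir β ∧ α < ψ ∧ ψ < β ∧ β < α + Real.pi := by
  obtain ⟨ε, hε, hball⟩ := h.exists_ball_subset hP hr hv
  obtain ⟨T, hT, hx⟩ := hball (v + (ε / 2) • dir ψ) (by
    rw [dist_eq_norm, add_sub_cancel_left, norm_smul, norm_dir, Real.norm_of_nonneg (by positivity)]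
    linarith)
  obtain ⟨a, b, rfl, ρ, σ, α, β, hρ, hσ, ha, hb, h1, h2⟩ := h.exists_polar hT
  obtain ⟨hav, hbv⟩ := h.ne_of_mem hT.1
  have hab : a ≠ b := by
    rintro rfl
    have := (h.smul_add_smul_eq_zero (s := 1) (t := -1) hT.1 (by module)).1
    norm_num at this
  rw [Finset.mem_convexHull'] at hx
  obtain ⟨w, hw0, hw1, hw2⟩ := hx
  rw [Finset.sum_insert (by simp [hav.symm, hbv.symm]), Finset.sum_pair hab] at hw1 hw2
  obtain ⟨s, t, hs, ht, hst⟩ : ∃ s t : ℝ, 0 ≤ s ∧ 0 ≤ t ∧ dir ψ = s • dir α + t • dir β := by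
    refine ⟨2 / ε * (w a * ρ), 2 / ε * (w b * σ), ?_, ?_, ?_⟩
    · have := hw0 a (by simp)
      positivity
    · have := hw0 b (by simp)
      positivity
    · have e1 : (ε / 2) • dir ψ = w a • (a - v) + w b • (b - v) := by
        have : w a • (a - v) + w b • (b - v)
            = (w v • v + (w a • a + w b • b)) - (w v + (w a + w b)) • v := by module
        rw [this, hw1, hw2]
        module
      have e2 : dir ψ = (2 / ε) • ((ε / 2) • dir ψ) := by
        rw [smul_smul]
        field_simp
        rw [one_smul]
      rw [e2, e1, ha, hb]
      module
  have hs0 : 0 < s := by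
    refine lt_of_le_of_ne hs fun h0 => ?_
    rw [← h0, zero_smul, zero_add] at hst
    have ht0 : 0 < t := by
      refine lt_of_le_of_ne ht fun h0 => ?_
      rw [← h0, zero_smul] at hst
      exact dir_ne_zero _ hst
    obtain ⟨k, rfl⟩ := eq_add_int_of_dir_eq_smul ht0 hst
    exact hψ (add_mem_polarAngles ⟨b, a, by rw [Finset.pair_comm]; exact hT.1, σ, hσ, hb⟩ k)
  have ht0 : 0 < t := by
    refine lt_of_le_of_ne ht fun h0 => ?_
    rw [← h0, zero_smul, add_zero] at hst
    obtain ⟨k, rfl⟩ := eq_add_int_of_dir_eq_smul hs0 hst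
    exact hψ (add_mem_polarAngles ⟨a, b, hT.1, ρ, hρ, ha⟩ k)
  -- For the shifted angle `ψ'`, the sines of `ψ' - α` and `β - ψ'` are `t` and `s` times that of `β
  -- - α`. Their positivity places `ψ'` between `α` and `β`. In the end `α` and `β` are shifted
  -- back, so that they surround `ψ` itself.
  obtain ⟨k, hk1, hk2⟩ := exists_shift_mem_Ico α ψ
  rw [← dir_add_int_mul_two_pi ψ k] at hst
  set ψ' := ψ + k * (2 * Real.pi) with hψ'
  have c0 : Real.cos ψ' = s * Real.cos α + t * Real.cos β := by
    simpa [dir] using congrFun (congrArg WithLp.ofLp hst) 0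
  have c1 : Real.sin ψ' = s * Real.sin α + t * Real.sin β := by
    simpa [dir] using congrFun (congrArg WithLp.ofLp hst) 1
  have s0 : 0 < Real.sin (β - α) := Real.sin_pos_of_pos_of_lt_pi (by linarith) (by linarith)
  have s1 : 0 < Real.sin (ψ' - α) := by
    have : Real.sin (ψ' - α) = t * Real.sin (β - α) := by
      rw [Real.sin_sub, Real.sin_sub, c0, c1]; ring
    rw [this]; positivity
  have s2 : 0 < Real.sin (β - ψ') := by
    have : Real.sin (β - ψ') = s * Real.sin (β - α) := by
      rw [Real.sin_sub, Real.sin_sub, c0, c1]; ring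
    rw [this]; positivity
  have l1 : α < ψ' := by
    refine lt_of_le_of_ne hk1 fun h0 => ?_
    rw [h0, sub_self, Real.sin_zero] at s1
    exact lt_irrefl _ s1
  have l2 : ψ' < α + Real.pi := by
    by_contra hh
    have : Real.sin (ψ' - α - Real.pi) = -Real.sin (ψ' - α) := Real.sin_sub_pi _
    have : 0 ≤ Real.sin (ψ' - α - Real.pi) :=
      Real.sin_nonneg_of_nonneg_of_le_pi (by linarith) (by linarith)
    linarith
  have l3 : ψ' < β := by
    by_contra hh
    have := Real.sin_nonpos_of_nonpos_of_neg_pi_le (x := β - ψ') (by linarith) (by linarith)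
    linarith
  refine ⟨a, b, hT.1, ρ, σ, α + (-k : ℤ) * (2 * Real.pi), β + (-k : ℤ) * (2 * Real.pi), hρ, hσ,
    ?_, ?_, ?_, ?_, ?_⟩
  · rw [dir_add_int_mul_two_pi, ha]
  · rw [dir_add_int_mul_two_pi, hb]
  all_goals push_cast; linarith

/-- The triangles at a vertex `v` form a cycle, and their angles at `v` add up to `2π`. -/
theorem IsFMTriangulation.exists_cycle (h : P.IsFMTriangulation 𝒯) (hP : P.Saturated)
    (hr : 0 < r) (hv : v ∈ P.centers) :
    ∃ n : ℕ, 3 ≤ n ∧ ∃ w : ℕ → Plane, (∀ j, w (j + n) = w j) ∧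
      Set.InjOn w (Set.Iio n) ∧
      (∀ T, T ∈ star 𝒯 v ↔ ∃ j < n, T = {v, w j, w (j + 1)}) ∧
      ∑ j ∈ Finset.range n, EuclideanGeometry.angle (w j) v (w (j + 1)) = 2 * Real.pi := by
  have hpi := Real.pi_pos
  have hne : (polarAngles 𝒯 v).Nonempty := by
    obtain ⟨T, hT, hvT⟩ := h.exists_mem v hv
    obtain ⟨a, b, rfl, ρ, σ, α, β, hρ, hσ, ha, -⟩ := h.exists_polar ⟨hT, hvT⟩
    exact ⟨α, a, b, hT, ρ, hρ, ha⟩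
  obtain ⟨n, hn, Φ, hmono, hrange, hper⟩ := exists_strictMono_enumeration Real.two_pi_pos
    (fun θ hθ k => add_mem_polarAngles hθ k) (finite_polarAngles (h.star_finite hP hr v)) hne
  have hmem : ∀ z, Φ z ∈ polarAngles 𝒯 v := fun z => hrange ▸ Set.mem_range_self z
  choose w w' hw ρ hρ hwρ using hmem
  have huniq : ∀ {a b : Plane} {σ : ℝ} {z : ℤ}, {v, a, b} ∈ 𝒯 → 0 < σ →
      a - v = σ • dir (Φ z) → a = w z := by
    intro a b σ z hT hσ ha
    refine h.eq_of_sameRay (hw z) hT (s := σ * (ρ z)⁻¹) (mul_pos hσ (inv_pos.2 (hρ z))) ?_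
    rw [hwρ, smul_smul, mul_assoc, inv_mul_cancel₀ (hρ z).ne', mul_one, ha]
  have hinj : ∀ z z', w z = w z' → ∃ k : ℤ, z = z' + k * n := by
    intro z z' hz
    have h1 : ρ z • dir (Φ z) = ρ z' • dir (Φ z') := by rw [← hwρ, ← hwρ, hz]
    obtain ⟨k, hk⟩ := eq_add_int_of_dir_eq_smul (α := Φ z) (β := Φ z') (c := (ρ z)⁻¹ * ρ z')
      (mul_pos (inv_pos.2 (hρ z)) (hρ z'))
      (by rw [mul_smul, ← h1, smul_smul, inv_mul_cancel₀ (hρ z).ne', one_smul])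
    exact ⟨k, hmono.injective (by rw [hk, hper])⟩
  have hwper : ∀ z k, w (z + k * n) = w z := by
    intro z k
    refine huniq (hw _) (hρ (z + k * n)) ?_
    rw [hwρ, hper, dir_add_int_mul_two_pi]
  have hstep : ∀ z, {v, w z, w (z + 1)} ∈ 𝒯 ∧ Φ (z + 1) < Φ z + Real.pi := by
    intro z
    have hlt := hmono (lt_add_one z)
    -- The midpoint of two consecutive angles is no polar angle, so a triangle surrounds it. Its own
    -- angles are values of `Φ` with none strictly between, hence exactly `Φ z` and `Φ (z + 1)`.
    have hψ : (Φ z + Φ (z + 1)) / 2 ∉ polarAngles 𝒯 v := by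
      rw [← hrange]
      rintro ⟨k, hk⟩
      have h1 : z < k := hmono.lt_iff_lt.1 (by linarith)
      have h2 : k < z + 1 := hmono.lt_iff_lt.1 (by linarith)
      omega
    obtain ⟨a, b, hT, τ, σ, α, β, hτ, hσ, ha, hb, h1, h2, h3⟩ :=
      h.exists_polar_around hP hr hv hψ
    have hT' : {v, b, a} ∈ 𝒯 := by rwa [Finset.pair_comm]
    obtain ⟨i, hi⟩ : α ∈ Set.range Φ := hrange ▸ ⟨a, b, hT, τ, hτ, ha⟩
    obtain ⟨j, hj⟩ : β ∈ Set.range Φ := hrange ▸ ⟨b, a, hT', σ, hσ, hb⟩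
    have hno : ∀ k, ¬ (α < Φ k ∧ Φ k < β) := fun k hk =>
      h.not_mem_polarAngles hT hτ hσ ha hb h3 hk.1 hk.2 (hrange ▸ Set.mem_range_self k)
    have hiz : i = z := by
      have h4 : i < z + 1 := hmono.lt_iff_lt.1 (by linarith)
      by_contra hne
      have : Φ i < Φ z := hmono (by omega)
      exact hno z ⟨by linarith, by linarith⟩
    have hjz : j = z + 1 := by
      have h4 : z < j := hmono.lt_iff_lt.1 (by linarith)
      by_contra hne
      have : Φ (z + 1) < Φ j := hmono (by omega)
      exact hno (z + 1) ⟨by linarith, by linarith⟩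
    subst hiz hjz
    rw [← hi] at ha h3
    rw [← hj] at hb h3
    rw [← huniq hT hτ ha, ← huniq hT' hσ hb]
    exact ⟨hT, h3⟩
  have hangle : ∀ z, EuclideanGeometry.angle (w z) v (w (z + 1)) = Φ (z + 1) - Φ z := fun z =>
    angle_of_polar (hρ z) (hρ (z + 1)) (hwρ z) (hwρ (z + 1)) (hmono (lt_add_one z)).le
      (hstep z).2.le
  have htotal : Φ n - Φ 0 = 2 * Real.pi := by
    have := hper 0 1
    simp only [Int.cast_one, one_mul, zero_add] at this
    linarith
  have hsum : ∑ j ∈ Finset.range n, (Φ ((j : ℤ) + 1) - Φ j) = 2 * Real.pi := by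
    rw [← htotal]
    have := Finset.sum_range_sub (fun j : ℕ => Φ (j : ℤ)) n
    push_cast at this
    exact this
  -- All `n` gaps are smaller than `π` and add up to `2π`.
  have hn3 : 3 ≤ n := by
    have h1 : 2 * Real.pi < ∑ j ∈ Finset.range n, Real.pi := by
      rw [← hsum]
      refine Finset.sum_lt_sum_of_nonempty ⟨0, by simpa using hn⟩ fun j _ => ?_
      linarith [(hstep j).2]
    rw [Finset.sum_const, Finset.card_range, nsmul_eq_mul] at h1
    have : (2 : ℝ) < n := lt_of_mul_lt_mul_right h1 hpi.le
    exact_mod_cast this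
  refine ⟨n, hn3, fun j => w j, fun j => ?_, ?_, ?_, ?_⟩
  · have := hwper j 1
    push_cast
    rwa [one_mul] at this
  · intro j hj k hk hjk
    obtain ⟨l, hl⟩ := hinj j k hjk
    have hj' : (j : ℤ) % n = j := Int.emod_eq_of_lt (by omega) (by simpa using hj)
    have hk' : (k : ℤ) % n = k := Int.emod_eq_of_lt (by omega) (by simpa using hk)
    rw [hl, Int.add_mul_emod_self_right, hk', ← hl] at hj'
    exact_mod_cast hj'.symm
  · intro T
    constructor
    · intro hT
      obtain ⟨a, b, rfl, τ, σ, α, β, hτ, hσ, ha, hb, h1, h3⟩ := h.exists_polar hT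
      have hT' : {v, b, a} ∈ 𝒯 := by rw [Finset.pair_comm]; exact hT.1
      obtain ⟨z, hz⟩ : α ∈ Set.range Φ := hrange ▸ ⟨a, b, hT.1, τ, hτ, ha⟩
      obtain ⟨j, hj⟩ : β ∈ Set.range Φ := hrange ▸ ⟨b, a, hT', σ, hσ, hb⟩
      have hjz : j = z + 1 := by
        have h4 : z < j := hmono.lt_iff_lt.1 (by linarith)
        by_contra hne
        have h5 : Φ (z + 1) < Φ j := hmono (by omega)
        have h6 := hmono (lt_add_one z)
        exact h.not_mem_polarAngles hT.1 hτ hσ ha hb h3 (θ := Φ (z + 1)) (by linarith)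
          (by linarith) (hrange ▸ Set.mem_range_self _)
      subst hjz
      rw [← hz] at ha
      rw [← hj] at hb
      have hn0 : (0 : ℤ) < n := by exact_mod_cast hn
      have e1 := Int.emod_nonneg z hn0.ne'
      have e2 := Int.emod_lt_of_pos z hn0
      have e3 : z = ((z % n).toNat : ℤ) + (z / n) * n := by
        rw [Int.toNat_of_nonneg e1]
        linarith [Int.emod_add_mul_ediv z n]
      refine ⟨(z % n).toNat, by omega, ?_⟩
      rw [huniq hT.1 hτ ha, huniq hT' hσ hb]
      push_cast
      rw [← hwper (z % n).toNat (z / n), ← e3, ← hwper ((z % n).toNat + 1) (z / n),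
        add_right_comm, ← e3]
    · rintro ⟨j, -, rfl⟩
      refine ⟨?_, by simp⟩
      have := (hstep j).1
      push_cast
      exact this
  · rw [← hsum]
    refine Finset.sum_congr rfl fun j _ => ?_
    rw [← hangle]
    push_cast
    rfl

end DiscPacking

/-! ### Taylor polynomials of sine and cosine -/

/-- The Taylor polynomial of degree `14` of the cosine. -/
noncomputable def cosPoly (x : ℝ) : ℝ :=
  1 - x ^ 2 / 2 + x ^ 4 / 24 - x ^ 6 / 720 + x ^ 8 / 40320 - x ^ 10 / 3628800
    + x ^ 12 / 479001600 - x ^ 14 / 87178291200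

/-- The Taylor polynomial of degree `15` of the sine. -/
noncomputable def sinPoly (x : ℝ) : ℝ :=
  x - x ^ 3 / 6 + x ^ 5 / 120 - x ^ 7 / 5040 + x ^ 9 / 362880 - x ^ 11 / 39916800
    + x ^ 13 / 6227020800 - x ^ 15 / 1307674368000

/-- Sine and cosine are treated together as parts of `exp (x * I)`: the remainder after 16 terms is
at most `17 / (16 * 16!) < 10⁻¹³` for `0 ≤ x ≤ 1`. -/
theorem norm_exp_mul_I_sub_le {x : ℝ} (h0 : 0 ≤ x) (h1 : x ≤ 1) :
    ‖Complex.exp (x * Complex.I) - (cosPoly x + sinPoly x * Complex.I)‖ ≤ 1 / 10 ^ 13 := by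
  have hx : ‖(x : ℂ) * Complex.I‖ = x := by
    rw [norm_mul, Complex.norm_I, mul_one, Complex.norm_real, Real.norm_of_nonneg h0]
  have h := Complex.exp_bound (x := x * Complex.I) (by rw [hx]; exact h1) (n := 16) (by norm_num)
  have e : ∑ m ∈ Finset.range 16, ((x : ℂ) * Complex.I) ^ m / (m.factorial : ℂ)
      = cosPoly x + sinPoly x * Complex.I := by
    have i2 := Complex.I_sq
    have i3 : Complex.I ^ 3 = -Complex.I := Complex.I_pow_three
    have i4 : Complex.I ^ 4 = 1 := Complex.I_pow_four
    have i5 : Complex.I ^ 5 = Complex.I := by rw [pow_succ, i4, one_mul]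
    have i6 : Complex.I ^ 6 = -1 := by rw [pow_add _ 4 2, i4, i2, one_mul]
    have i7 : Complex.I ^ 7 = -Complex.I := by rw [pow_add _ 4 3, i4, i3, one_mul]
    have i8 : Complex.I ^ 8 = 1 := by rw [pow_add _ 4 4, i4, one_mul]
    have i9 : Complex.I ^ 9 = Complex.I := by rw [pow_succ, i8, one_mul]
    have i10 : Complex.I ^ 10 = -1 := by rw [pow_add _ 8 2, i8, i2, one_mul]
    have i11 : Complex.I ^ 11 = -Complex.I := by rw [pow_add _ 8 3, i8, i3, one_mul]
    have i12 : Complex.I ^ 12 = 1 := by rw [pow_add _ 8 4, i8, i4, one_mul]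
    have i13 : Complex.I ^ 13 = Complex.I := by rw [pow_succ, i12, one_mul]
    have i14 : Complex.I ^ 14 = -1 := by rw [pow_add _ 12 2, i12, i2, one_mul]
    have i15 : Complex.I ^ 15 = -Complex.I := by rw [pow_add _ 12 3, i12, i3, one_mul]
    simp only [Finset.sum_range_succ, Finset.sum_range_zero, mul_pow, i2, i3, i4, i5, i6, i7, i8,
      i9, i10, i11, i12, i13, i14, i15, cosPoly, sinPoly, Nat.factorial]
    push_cast
    ring
  rw [e, hx] at h
  refine h.trans ?_
  have h16 : x ^ 16 ≤ 1 := pow_le_one₀ h0 h1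
  calc x ^ 16 * ((Nat.succ 16 : ℕ) * ((Nat.factorial 16 : ℕ) * (16 : ℕ) : ℝ)⁻¹)
      ≤ 1 * ((Nat.succ 16 : ℕ) * ((Nat.factorial 16 : ℕ) * (16 : ℕ) : ℝ)⁻¹) := by gcongr
    _ ≤ 1 / 10 ^ 13 := by norm_num [Nat.factorial]

theorem abs_cos_sub_cosPoly_le {x : ℝ} (h0 : 0 ≤ x) (h1 : x ≤ 1) :
    |Real.cos x - cosPoly x| ≤ 1 / 10 ^ 13 := by
  refine le_trans ?_ ((Complex.abs_re_le_norm _).trans (norm_exp_mul_I_sub_le h0 h1))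
  simp [Complex.exp_ofReal_mul_I_re]

theorem abs_sin_sub_sinPoly_le {x : ℝ} (h0 : 0 ≤ x) (h1 : x ≤ 1) :
    |Real.sin x - sinPoly x| ≤ 1 / 10 ^ 13 := by
  refine le_trans ?_ ((Complex.abs_im_le_norm _).trans (norm_exp_mul_I_sub_le h0 h1))
  simp [Complex.exp_ofReal_mul_I_im]

/-- By monotonicity, this bound and the three that follow reduce the enclosure of an inverse
function to a polynomial inequality at a rational point. -/
theorem le_arccos_of_cosPoly {x y : ℝ} (h0 : 0 ≤ x) (h1 : x ≤ 1)
    (h : y ≤ cosPoly x - 1 / 10 ^ 13) : x ≤ Real.arccos y := by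
  have := (abs_le.1 (abs_cos_sub_cosPoly_le h0 h1)).1
  rw [← Real.arccos_cos h0 (by linarith [Real.pi_gt_three])]
  exact Real.arccos_le_arccos (by linarith)

theorem arccos_le_of_cosPoly {x y : ℝ} (h0 : 0 ≤ x) (h1 : x ≤ 1)
    (h : cosPoly x + 1 / 10 ^ 13 ≤ y) : Real.arccos y ≤ x := by
  have := (abs_le.1 (abs_cos_sub_cosPoly_le h0 h1)).2
  rw [← Real.arccos_cos h0 (by linarith [Real.pi_gt_three])]
  exact Real.arccos_le_arccos (by linarith)

theorem le_arcsin_of_sinPoly {x y : ℝ} (h0 : 0 ≤ x) (h1 : x ≤ 1)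
    (h : sinPoly x + 1 / 10 ^ 13 ≤ y) : x ≤ Real.arcsin y := by
  have := (abs_le.1 (abs_sin_sub_sinPoly_le h0 h1)).2
  rw [← Real.arcsin_sin (x := x) (by linarith [Real.pi_pos]) (by linarith [Real.pi_gt_three])]
  exact Real.monotone_arcsin (by linarith)

theorem arcsin_le_of_sinPoly {x y : ℝ} (h0 : 0 ≤ x) (h1 : x ≤ 1)
    (h : y ≤ sinPoly x - 1 / 10 ^ 13) : Real.arcsin y ≤ x := by
  have := (abs_le.1 (abs_sin_sub_sinPoly_le h0 h1)).1
  rw [← Real.arcsin_sin (x := x) (by linarith [Real.pi_pos]) (by linarith [Real.pi_gt_three])]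
  exact Real.monotone_arcsin (by linarith)

/-! ### Angles, areas and coverings of the tight triangles -/

theorem tightAngle_comm (a b c : ℝ) : tightAngle a b c = tightAngle c b a := by
  unfold tightAngle
  congr 1
  ring

theorem tightAngle_self {a : ℝ} (ha : 0 < a) : tightAngle a a a = Real.pi / 3 := by
  have h : ((a + a) ^ 2 + (a + a) ^ 2 - (a + a) ^ 2) / (2 * (a + a) * (a + a)) = 1 / 2 := by
    field_simp
    ring
  rw [tightAngle, h, ← Real.cos_pi_div_three, Real.arccos_cos (by positivity)
    (by linarith [Real.pi_pos])]

section

variable {r : ℝ}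

/-- The altitude of the isosceles triangle with discs `1, 1, r` leaves a right triangle with
hypotenuse `1 + r` and leg `1`. For discs `1, r, r` the leg is `r`. So all angles of mixed tight
triangles are expressed by `arccos (1 / (1 + r))` and `arcsin (r / (1 + r))`. -/
theorem tightAngle_one_one (hr : 0 < r) : tightAngle 1 1 r = Real.arccos (1 / (1 + r)) := by
  unfold tightAngle
  congr 1
  field_simp
  ring

theorem tightAngle_one_r_one (hr : 0 < r) :
    tightAngle 1 r 1 = Real.pi - 2 * Real.arccos (1 / (1 + r)) := by
  have h0 := Real.arccos_nonneg (1 / (1 + r))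
  have h1 : Real.arccos (1 / (1 + r)) ≤ Real.pi / 2 := Real.arccos_le_pi_div_two.2 (by positivity)
  rw [← Real.arccos_cos (x := Real.pi - 2 * _) (by linarith) (by linarith), Real.cos_pi_sub,
    Real.cos_two_mul, Real.cos_arccos]
  · unfold tightAngle
    congr 1
    field_simp
    ring
  · have : 0 ≤ 1 / (1 + r) := by positivity
    linarith
  · rw [div_le_one (by positivity)]
    linarith

theorem arcsin_bounds (hr : 0 < r) : 0 ≤ Real.arcsin (r / (1 + r)) ∧
    Real.arcsin (r / (1 + r)) ≤ Real.pi / 2 ∧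
    Real.sin (Real.arcsin (r / (1 + r))) = r / (1 + r) := by
  have h0 : 0 ≤ r / (1 + r) := by positivity
  refine ⟨Real.arcsin_nonneg.2 h0, Real.arcsin_le_pi_div_two _, Real.sin_arcsin (by linarith) ?_⟩
  rw [div_le_one (by positivity)]
  linarith

theorem tightAngle_r_one_r (hr : 0 < r) :
    tightAngle r 1 r = 2 * Real.arcsin (r / (1 + r)) := by
  obtain ⟨h0, h1, h2⟩ := arcsin_bounds hr
  rw [← Real.arccos_cos (x := 2 * _) (by linarith) (by linarith), Real.cos_two_mul, Real.cos_sq',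
    h2]
  unfold tightAngle
  congr 1
  field_simp
  ring

theorem tightAngle_one_r_r (hr : 0 < r) :
    tightAngle 1 r r = Real.pi / 2 - Real.arcsin (r / (1 + r)) := by
  obtain ⟨h0, h1, h2⟩ := arcsin_bounds hr
  rw [← Real.arccos_cos (x := Real.pi / 2 - _) (by linarith) (by linarith),
    Real.cos_pi_div_two_sub, h2]
  unfold tightAngle
  congr 1
  field_simp
  ring

theorem tightCov_self {a : ℝ} (ha : 0 < a) : tightCov a a a = a ^ 2 * (Real.pi / 2) := by
  rw [tightCov, tightAngle_self ha]
  ring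

theorem tightCov_one_one_r (hr : 0 < r) : tightCov 1 1 r =
    Real.arccos (1 / (1 + r)) + r ^ 2 * (Real.pi / 2 - Real.arccos (1 / (1 + r))) := by
  rw [tightCov, tightAngle_one_one hr, tightAngle_one_r_one hr]
  ring

theorem tightCov_one_r_r (hr : 0 < r) : tightCov 1 r r =
    Real.arcsin (r / (1 + r)) + r ^ 2 * (Real.pi / 2 - Real.arcsin (r / (1 + r))) := by
  rw [tightCov, tightAngle_r_one_r hr, tightAngle_one_r_r hr]
  ring

theorem tightArea_self {a : ℝ} (ha : 0 < a) : tightArea a a a = a ^ 2 * Real.sqrt 3 := by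
  rw [tightArea, show (a + a + a) * a * a * a = (a ^ 2) ^ 2 * 3 by ring,
    Real.sqrt_mul (by positivity), Real.sqrt_sq (by positivity)]

theorem tightArea_one_one_r : tightArea 1 1 r = Real.sqrt ((2 + r) * r) := by
  rw [tightArea]
  congr 1
  ring

theorem tightArea_one_r_r (hr : 0 < r) : tightArea 1 r r = r * Real.sqrt (1 + 2 * r) := by
  rw [tightArea, show (1 + r + r) * 1 * r * r = r ^ 2 * (1 + 2 * r) by ring,
    Real.sqrt_mul (by positivity), Real.sqrt_sq hr.le]

end

/-! ### Enclosures of the roots -/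

/-- Together with `le_pow_sub_pow`, a mean value estimate: the increment of each monomial is
enclosed between constant multiples of `y - x`. -/
theorem pow_sub_pow_le {b x y : ℝ} (hx : 0 ≤ x) (hxy : x ≤ y) (hy : y ≤ b) (k : ℕ) :
    y ^ (k + 1) - x ^ (k + 1) ≤ (k + 1) * b ^ k * (y - x) := by
  induction k with
  | zero => simp
  | succ k ih =>
    have hb : 0 ≤ b := by linarith
    have h1 : x ^ (k + 1) ≤ b ^ (k + 1) := pow_le_pow_left₀ hx (by linarith) _
    have h2 : y * (y ^ (k + 1) - x ^ (k + 1)) ≤ b * ((k + 1) * b ^ k * (y - x)) :=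
      mul_le_mul hy ih (sub_nonneg.2 (pow_le_pow_left₀ hx hxy _)) hb
    have h3 := mul_le_mul_of_nonneg_right h1 (sub_nonneg.2 hxy)
    push_cast
    calc y ^ (k + 1 + 1) - x ^ (k + 1 + 1)
        = y * (y ^ (k + 1) - x ^ (k + 1)) + x ^ (k + 1) * (y - x) := by ring
      _ ≤ b * ((k + 1) * b ^ k * (y - x)) + b ^ (k + 1) * (y - x) := add_le_add h2 h3
      _ = _ := by ring

theorem le_pow_sub_pow {a x y : ℝ} (ha : 0 ≤ a) (hx : a ≤ x) (hxy : x ≤ y) (k : ℕ) :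
    (k + 1) * a ^ k * (y - x) ≤ y ^ (k + 1) - x ^ (k + 1) := by
  induction k with
  | zero => simp
  | succ k ih =>
    have h1 : a ^ (k + 1) ≤ x ^ (k + 1) := pow_le_pow_left₀ ha hx _
    have h2 : a * ((k + 1) * a ^ k * (y - x)) ≤ y * (y ^ (k + 1) - x ^ (k + 1)) :=
      mul_le_mul (by linarith) ih (mul_nonneg (by positivity) (by linarith)) (by linarith)
    have h3 := mul_le_mul_of_nonneg_right h1 (sub_nonneg.2 hxy)
    push_cast
    calc (k + 1 + 1) * a ^ (k + 1) * (y - x)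
        = a * ((k + 1) * a ^ k * (y - x)) + a ^ (k + 1) * (y - x) := by ring
      _ ≤ y * (y ^ (k + 1) - x ^ (k + 1)) + x ^ (k + 1) * (y - x) := add_le_add h2 h3
      _ = _ := by ring

/-- On `[a_i, a_i + 1/100]`, the `i`-th polynomial is strictly monotone. -/
theorem radiusPoly_strict {i : ℕ} (hi : i ∈ Set.Icc 1 9) {x y : ℝ} (hx : radiusApprox i ≤ x)
    (hxy : x < y) (hy : y ≤ radiusApprox i + 1 / 100) :
    if i ∈ [3, 4, 7, 8] then radiusPoly i x < radiusPoly i y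
    else radiusPoly i y < radiusPoly i x := by
  have h0 : 0 ≤ radiusApprox i := by unfold radiusApprox; split <;> norm_num
  have hu := fun k => pow_sub_pow_le (h0.trans hx) hxy.le hy k
  have hl := fun k => le_pow_sub_pow h0 hx hxy.le k
  -- With these bounds, monotonicity of the polynomials becomes a linear statement about the
  -- increments of the powers. The increasing cases are 3, 4, 7 and 8.
  have u1 := hu 1
  have u2 := hu 2
  have u3 := hu 3
  have u4 := hu 4
  have u5 := hu 5
  have u6 := hu 6
  have u7 := hu 7
  have l1 := hl 1
  have l2 := hl 2
  have l3 := hl 3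
  have l4 := hl 4
  have l5 := hl 5
  have l6 := hl 6
  have l7 := hl 7
  clear hu hl h0 hx hy
  obtain ⟨h1, h9⟩ := hi
  interval_cases i <;> norm_num [radiusApprox] at u1 u2 u3 u4 u5 u6 u7 l1 l2 l3 l4 l5 l6 l7 <;>
    norm_num [radiusPoly] <;> linarith

/-! ### Numerical enclosures -/

/-- Approximations, in units of `10⁻¹²`, of `r`, `√((2 + r) r)`, `√(1 + 2r)`, the angles
`arccos (1 / (1 + r))` and `arcsin (r / (1 + r))`, the target density and the excesses of the four
tight triangles. -/
structure Enclosure where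
  r : ℤ
  s : ℤ
  t : ℤ
  g : ℤ
  h : ℤ
  d : ℤ
  e₀ : ℤ
  e₁ : ℤ
  e₂ : ℤ
  e₃ : ℤ

/-- The approximations for the nine radii. -/
def enclosure (i : ℕ) : Enclosure :=
  match i with
  | 1 => ⟨637555977232, 1296761187948, 1508347424987, 913894794272, 399908270774, 910683199819,
      6553244890, 28059559, -84178676, 2663747413⟩
  | 2 => ⟨545151042123, 1177918394021, 1445787703726, 866909108849, 360576884695, 911627477507,
      8188781824, -2274336682, -1721721610, 2433621276⟩
  | 3 => ⟨533296416660, 1162324352900, 1437564897081, 860327004681, 355234661057, 914179482131,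
      12608983494, 184994438, -92497219, 3586058808⟩
  | 4 => ⟨414213562373, 1000000000000, 1352193449454, 785398163397, 297251361321, 920151184511,
      22952275422, 0, -383338383, 3937987888⟩
  | 5 => ⟨386106104859, 959838597852, 1331244609272, 764908832314, 282288718883, 920063472922,
      22800354494, -1936433353, -1462596166, 3399029519⟩
  | 6 => ⟨349198186209, 905723879374, 1303225372841, 735968480680, 261799387799, 924648910382,
      30742565150, -290266838, -624788188, 3748729127⟩
  | 7 => ⟨280776406404, 800242590220, 1249621067688, 674888845586, 221018635623, 931901334344,
      43304131930, 229076002, -458152003, 3413898146⟩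
  | 8 => ⟨154700538379, 577350269190, 1144290643481, 523598775598, 134378657762, 950307993877,
      75185401439, 0, -529592478, 1799356318⟩
  | 9 => ⟨101020514434, 460701826786, 1096376317177, 431717842526, 91880933072, 962429935045,
      96181219429, 50926360, -378107435, 981543227⟩
  | _ => ⟨0, 0, 0, 0, 0, 0, 0, 0, 0, 0⟩

/-- The real `x` is at most `k` units of `10⁻¹²` away from `n`. -/
def Near (x : ℝ) (n k : ℤ) : Prop := (n - k : ℝ) / 10 ^ 12 ≤ x ∧ x ≤ (n + k : ℝ) / 10 ^ 12

/-- The polynomial has opposite signs at the two rational endpoints and is strictly monotone, so its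
root lies between them. -/
theorem radius_near {i : ℕ} (hi : i ∈ Set.Icc 1 9) {r : ℝ} (hr : IsTargetRadius i r) :
    Near r (enclosure i).r 1 := by
  obtain ⟨h0, h1, h2⟩ := hr
  have hlo : radiusApprox i ≤ ((enclosure i).r - 1 : ℝ) / 10 ^ 12 ∧
      ((enclosure i).r + 1 : ℝ) / 10 ^ 12 ≤ radiusApprox i + 1 / 100 := by
    obtain ⟨h1, h9⟩ := hi
    interval_cases i <;> norm_num [enclosure, radiusApprox]
  have hsign : if i ∈ [3, 4, 7, 8] then
      radiusPoly i (((enclosure i).r - 1 : ℝ) / 10 ^ 12) < 0 ∧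
        0 < radiusPoly i (((enclosure i).r + 1 : ℝ) / 10 ^ 12)
      else 0 < radiusPoly i (((enclosure i).r - 1 : ℝ) / 10 ^ 12) ∧
        radiusPoly i (((enclosure i).r + 1 : ℝ) / 10 ^ 12) < 0 := by
    clear h0 h1 h2 hlo
    obtain ⟨h1, h9⟩ := hi
    interval_cases i <;> norm_num [enclosure, radiusPoly]
  unfold Near
  push_cast
  constructor
  · by_contra hh
    have := radiusPoly_strict hi h1 (not_le.1 hh) (le_trans (by gcongr; linarith) hlo.2)
    split_ifs at this hsign <;> linarith
  · by_contra hh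
    have := radiusPoly_strict hi (le_trans hlo.1 (by gcongr; linarith)) (not_le.1 hh) h2.le
    split_ifs at this hsign <;> linarith

theorem sqrt_three_near : Near (Real.sqrt 3) 1732050807569 1 := by
  constructor
  · apply Real.le_sqrt_of_sq_le
    norm_num
  · apply Real.sqrt_le_iff.2
    norm_num

theorem pi_near : (3141592653589 : ℝ) / 10 ^ 12 ≤ Real.pi ∧
    Real.pi ≤ (3141592653590 : ℝ) / 10 ^ 12 := by
  have h1 := Real.pi_gt_d20
  have h2 := Real.pi_lt_d20
  constructor <;> linarith

theorem sqrt_near {x : ℝ} {n k : ℤ} (h0 : 0 ≤ (n + k : ℝ) / 10 ^ 12)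
    (h1 : ((n - k : ℝ) / 10 ^ 12) ^ 2 ≤ x)
    (h2 : x ≤ ((n + k : ℝ) / 10 ^ 12) ^ 2) : Near (Real.sqrt x) n k :=
  ⟨Real.le_sqrt_of_sq_le h1, Real.sqrt_le_iff.2 ⟨h0, h2⟩⟩

/-- All four quantities increase with `r`, so they are enclosed by bounds at the two ends of the
interval for `r`. Four units suffice for the propagated uncertainty and the rounding. -/
theorem inputs_near {i : ℕ} (hi : i ∈ Set.Icc 1 9) {r : ℝ} (hr : Near r (enclosure i).r 1) :
    Near (Real.sqrt ((2 + r) * r)) (enclosure i).s 4 ∧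
    Near (Real.sqrt (1 + 2 * r)) (enclosure i).t 4 ∧
    Near (Real.arccos (1 / (1 + r))) (enclosure i).g 4 ∧
    Near (Real.arcsin (r / (1 + r))) (enclosure i).h 4 := by
  obtain ⟨h1, h2⟩ := hr
  push_cast at h1 h2
  set l : ℝ := ((enclosure i).r - 1 : ℝ) / 10 ^ 12 with hl
  set u : ℝ := ((enclosure i).r + 1 : ℝ) / 10 ^ 12 with hu
  have hl0 : 0 < l := by
    obtain ⟨h1, h9⟩ := hi
    clear hu u h2
    interval_cases i <;> norm_num [hl, enclosure]
  have hr0 : 0 < r := by linarith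
  have hu0 : 0 < u := by linarith
  have a1 : (2 + l) * l ≤ (2 + r) * r := by gcongr
  have a2 : (2 + r) * r ≤ (2 + u) * u := by gcongr
  have b1 : 1 / (1 + u) ≤ 1 / (1 + r) := by gcongr
  have b2 : 1 / (1 + r) ≤ 1 / (1 + l) := by gcongr
  have e : ∀ x : ℝ, 0 < x → x / (1 + x) = 1 - 1 / (1 + x) := by
    intro x hx
    field_simp
    ring
  have c1 : l / (1 + l) ≤ r / (1 + r) := by rw [e _ hl0, e _ hr0]; linarith
  have c2 : r / (1 + r) ≤ u / (1 + u) := by rw [e _ (hr0.trans_le h2), e _ hr0]; linarith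
  have ds : 0 ≤ ((enclosure i).s + (4 : ℤ) : ℝ) / 10 ^ 12 ∧
      (((enclosure i).s - (4 : ℤ) : ℝ) / 10 ^ 12) ^ 2 ≤ (2 + l) * l ∧
      (2 + u) * u ≤ (((enclosure i).s + (4 : ℤ) : ℝ) / 10 ^ 12) ^ 2 := by
    clear_value l u
    subst hl hu
    clear h1 h2 hl0 hu0 hr0 a1 a2 b1 b2 c1 c2
    obtain ⟨h1, h9⟩ := hi
    interval_cases i <;> norm_num [enclosure]
  have dt : 0 ≤ ((enclosure i).t + (4 : ℤ) : ℝ) / 10 ^ 12 ∧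
      (((enclosure i).t - (4 : ℤ) : ℝ) / 10 ^ 12) ^ 2 ≤ 1 + 2 * l ∧
      1 + 2 * u ≤ (((enclosure i).t + (4 : ℤ) : ℝ) / 10 ^ 12) ^ 2 := by
    clear_value l u
    subst hl hu
    clear h1 h2 hl0 hu0 hr0 a1 a2 b1 b2 c1 c2 ds
    obtain ⟨h1, h9⟩ := hi
    interval_cases i <;> norm_num [enclosure]
  have dg : 0 ≤ ((enclosure i).g - (4 : ℤ) : ℝ) / 10 ^ 12 ∧
      ((enclosure i).g + (4 : ℤ) : ℝ) / 10 ^ 12 ≤ 1 ∧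
      1 / (1 + l) ≤ cosPoly (((enclosure i).g - (4 : ℤ) : ℝ) / 10 ^ 12) - 1 / 10 ^ 13 ∧
      cosPoly (((enclosure i).g + (4 : ℤ) : ℝ) / 10 ^ 12) + 1 / 10 ^ 13 ≤ 1 / (1 + u) := by
    clear_value l u
    subst hl hu
    clear h1 h2 hl0 hu0 hr0 a1 a2 b1 b2 c1 c2 ds dt
    obtain ⟨h1, h9⟩ := hi
    interval_cases i <;> norm_num [enclosure, cosPoly]
  have dh : 0 ≤ ((enclosure i).h - (4 : ℤ) : ℝ) / 10 ^ 12 ∧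
      ((enclosure i).h + (4 : ℤ) : ℝ) / 10 ^ 12 ≤ 1 ∧
      sinPoly (((enclosure i).h - (4 : ℤ) : ℝ) / 10 ^ 12) + 1 / 10 ^ 13 ≤ l / (1 + l) ∧
      u / (1 + u) ≤ sinPoly (((enclosure i).h + (4 : ℤ) : ℝ) / 10 ^ 12) - 1 / 10 ^ 13 := by
    clear_value l u
    subst hl hu
    clear h1 h2 hl0 hu0 hr0 a1 a2 b1 b2 c1 c2 ds dt dg
    obtain ⟨h1, h9⟩ := hi
    interval_cases i <;> norm_num [enclosure, sinPoly]
  have hlu : ∀ n : ℤ, ((n : ℝ) - (4 : ℤ)) / 10 ^ 12 ≤ ((n : ℝ) + (4 : ℤ)) / 10 ^ 12 := by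
    intro n
    gcongr
    push_cast
    linarith
  refine ⟨sqrt_near ds.1 (by linarith [ds.2.1]) (by linarith [ds.2.2]),
    sqrt_near dt.1 (by linarith [dt.2.1]) (by linarith [dt.2.2]), ⟨?_, ?_⟩, ⟨?_, ?_⟩⟩
  · exact le_arccos_of_cosPoly dg.1 ((hlu _).trans dg.2.1) (b2.trans dg.2.2.1)
  · exact arccos_le_of_cosPoly (dg.1.trans (hlu _)) dg.2.1 (dg.2.2.2.trans b1)
  · exact le_arcsin_of_sinPoly dh.1 ((hlu _).trans dh.2.1) (dh.2.2.1.trans c1)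
  · exact arcsin_le_of_sinPoly (dh.1.trans (hlu _)) dh.2.1 (c2.trans dh.2.2.2)

/-- Lower and upper bounds for the area of a tight triangle with `k` small discs. -/
noncomputable def Enclosure.area (e : Enclosure) (k : Fin 4) : ℝ × ℝ :=
  match k with
  | 0 => (1732050807568 / 10 ^ 12, 1732050807570 / 10 ^ 12)
  | 1 => ((e.s - 4) / 10 ^ 12, (e.s + 4) / 10 ^ 12)
  | 2 => ((e.r - 1) / 10 ^ 12 * ((e.t - 4) / 10 ^ 12), (e.r + 1) / 10 ^ 12 * ((e.t + 4) / 10 ^ 12))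
  | 3 => (((e.r - 1) / 10 ^ 12) ^ 2 * (1732050807568 / 10 ^ 12),
      ((e.r + 1) / 10 ^ 12) ^ 2 * (1732050807570 / 10 ^ 12))

/-- Lower and upper bounds for the covered area of a tight triangle with `k` small discs. -/
noncomputable def Enclosure.cov (e : Enclosure) (k : Fin 4) : ℝ × ℝ :=
  match k with
  | 0 => (3141592653589 / 10 ^ 12 / 2, 3141592653590 / 10 ^ 12 / 2)
  | 1 => ((e.g - 4) / 10 ^ 12
        + ((e.r - 1) / 10 ^ 12) ^ 2 * (3141592653589 / 10 ^ 12 / 2 - (e.g + 4) / 10 ^ 12),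
      (e.g + 4) / 10 ^ 12
        + ((e.r + 1) / 10 ^ 12) ^ 2 * (3141592653590 / 10 ^ 12 / 2 - (e.g - 4) / 10 ^ 12))
  | 2 => ((e.h - 4) / 10 ^ 12
        + ((e.r - 1) / 10 ^ 12) ^ 2 * (3141592653589 / 10 ^ 12 / 2 - (e.h + 4) / 10 ^ 12),
      (e.h + 4) / 10 ^ 12
        + ((e.r + 1) / 10 ^ 12) ^ 2 * (3141592653590 / 10 ^ 12 / 2 - (e.h - 4) / 10 ^ 12))
  | 3 => (((e.r - 1) / 10 ^ 12) ^ 2 * (3141592653589 / 10 ^ 12 / 2),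
      ((e.r + 1) / 10 ^ 12) ^ 2 * (3141592653590 / 10 ^ 12 / 2))

theorem mem_excess_bounds {δ A C Al Ah Cl Ch dl dh : ℝ} (hd : 0 ≤ dl) (hAl : 0 ≤ Al)
    (h1 : dl ≤ δ ∧ δ ≤ dh) (h2 : Al ≤ A ∧ A ≤ Ah) (h3 : Cl ≤ C ∧ C ≤ Ch) {n : ℤ}
    (h4 : (n - (200 : ℤ) : ℝ) / 10 ^ 12 ≤ dl * Al - Ch)
    (h5 : dh * Ah - Cl ≤ (n + (200 : ℤ) : ℝ) / 10 ^ 12) : Near (δ * A - C) n 200 := by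
  have a1 : dl * Al ≤ δ * A := mul_le_mul h1.1 h2.1 hAl (hd.trans h1.1)
  have a2 : δ * A ≤ dh * Ah :=
    mul_le_mul h1.2 h2.2 (hAl.trans h2.1) (hd.trans (h1.1.trans h1.2))
  constructor <;> linarith [h3.1, h3.2]

/-- Both mixed tight triangles have covered area `θ + r² (x - θ)` with `x = π / 2`. The two
occurrences of `θ` are bounded independently. -/
theorem mem_cov_bounds {r l u θ a b p q x : ℝ} (hl : 0 ≤ l) (hb : b ≤ p) (h1 : l ≤ r) (h2 : r ≤ u)
    (h3 : a ≤ θ) (h4 : θ ≤ b) (h5 : p ≤ x) (h6 : x ≤ q) :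
    a + l ^ 2 * (p - b) ≤ θ + r ^ 2 * (x - θ) ∧ θ + r ^ 2 * (x - θ) ≤ b + u ^ 2 * (q - a) := by
  have a1 : l ^ 2 * (p - b) ≤ r ^ 2 * (x - θ) :=
    mul_le_mul (pow_le_pow_left₀ hl h1 2) (by linarith) (by linarith) (sq_nonneg r)
  have a2 : r ^ 2 * (x - θ) ≤ u ^ 2 * (q - a) :=
    mul_le_mul (pow_le_pow_left₀ (hl.trans h1) h2 2) (by linarith) (by linarith) (sq_nonneg u)
  constructor <;> linarith

theorem enclosure_nonneg {i : ℕ} (hi : i ∈ Set.Icc 1 9) {e : Enclosure} (he : e = enclosure i) :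
    0 ≤ (e.r - 1 : ℝ) / 10 ^ 12 ∧ 0 ≤ (e.t - 4 : ℝ) / 10 ^ 12 ∧
      (e.g + 4 : ℝ) / 10 ^ 12 ≤ 3141592653589 / 10 ^ 12 / 2 ∧
      (e.h + 4 : ℝ) / 10 ^ 12 ≤ 3141592653589 / 10 ^ 12 / 2 ∧ 0 ≤ (e.d - 60 : ℝ) / 10 ^ 12 ∧
      0 < (e.area 0).1 ∧ 0 < (e.area 1).1 ∧ 0 < (e.area 2).1 ∧ 0 < (e.area 3).1 := by
  subst he
  obtain ⟨h1, h9⟩ := hi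
  interval_cases i <;> norm_num [enclosure, Enclosure.area]

/-- These are the bounds on the density with the denominator cleared, covered area and total area
each taken at its unfavourable end. -/
theorem enclosure_density {i : ℕ} (hi : i ∈ Set.Icc 1 9) {e : Enclosure} (he : e = enclosure i) :
    (e.d - 60 : ℝ) / 10 ^ 12 * ((targetCount i).1 * (e.area 0).2
        + (targetCount i).2.1 * (e.area 1).2 + (targetCount i).2.2.1 * (e.area 2).2
        + (targetCount i).2.2.2 * (e.area 3).2)
      ≤ (targetCount i).1 * (e.cov 0).1 + (targetCount i).2.1 * (e.cov 1).1
        + (targetCount i).2.2.1 * (e.cov 2).1 + (targetCount i).2.2.2 * (e.cov 3).1 ∧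
    (targetCount i).1 * (e.cov 0).2 + (targetCount i).2.1 * (e.cov 1).2
        + (targetCount i).2.2.1 * (e.cov 2).2 + (targetCount i).2.2.2 * (e.cov 3).2
      ≤ (e.d + 60 : ℝ) / 10 ^ 12 * ((targetCount i).1 * (e.area 0).1
        + (targetCount i).2.1 * (e.area 1).1 + (targetCount i).2.2.1 * (e.area 2).1
        + (targetCount i).2.2.2 * (e.area 3).1) := by
  subst he
  obtain ⟨h1, h9⟩ := hi
  interval_cases i <;> norm_num [enclosure, Enclosure.area, Enclosure.cov, targetCount]

theorem enclosure_excess {i : ℕ} (hi : i ∈ Set.Icc 1 9) {e : Enclosure} (he : e = enclosure i)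
    (k : Fin 4) :
    (![e.e₀, e.e₁, e.e₂, e.e₃] k - (200 : ℤ) : ℝ) / 10 ^ 12
        ≤ (e.d - 60 : ℝ) / 10 ^ 12 * (e.area k).1 - (e.cov k).2 ∧
      (e.d + 60 : ℝ) / 10 ^ 12 * (e.area k).2 - (e.cov k).1
        ≤ (![e.e₀, e.e₁, e.e₂, e.e₃] k + (200 : ℤ) : ℝ) / 10 ^ 12 := by
  subst he
  obtain ⟨h1, h9⟩ := hi
  fin_cases k <;> interval_cases i <;> norm_num [enclosure, Enclosure.area, Enclosure.cov]

theorem excess_near {i : ℕ} (hi : i ∈ Set.Icc 1 9) {r : ℝ} (hr0 : 0 < r)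
    (hr : Near r (enclosure i).r 1) :
    Near (tightExcess i r large large large) (enclosure i).e₀ 200 ∧
    Near (tightExcess i r large large small) (enclosure i).e₁ 200 ∧
    Near (tightExcess i r large small small) (enclosure i).e₂ 200 ∧
    Near (tightExcess i r small small small) (enclosure i).e₃ 200 := by
  obtain ⟨hs, ht, hg, hh⟩ := inputs_near hi hr
  have hq := sqrt_three_near
  have hp := pi_near
  unfold Near at hr hs ht hg hh hq
  push_cast at hr hs ht hg hh hq
  norm_num only at hq
  set e := enclosure i with he
  have hpos := enclosure_nonneg hi he
  have hcheck := enclosure_density hi he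
  have hfinal := enclosure_excess hi he
  have hcount : 0 ≤ (targetCount i).1 ∧ 0 ≤ (targetCount i).2.1 ∧ 0 ≤ (targetCount i).2.2.1 ∧
      0 ≤ (targetCount i).2.2.2 ∧ 0 < (targetCount i).1 + (targetCount i).2.1
        + (targetCount i).2.2.1 + (targetCount i).2.2.2 := by
    unfold targetCount
    split <;> norm_num
  obtain ⟨p1, p2, p3, p4, p5, p6, p7, p8, p9⟩ := hpos
  obtain ⟨n0, n1, n2, n3, n4⟩ := hcount
  have A0 : (e.area 0).1 ≤ Real.sqrt 3 ∧ Real.sqrt 3 ≤ (e.area 0).2 := by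
    simp only [Enclosure.area]
    constructor <;> linarith [hq.1, hq.2]
  have A1 : (e.area 1).1 ≤ Real.sqrt ((2 + r) * r) ∧ Real.sqrt ((2 + r) * r) ≤ (e.area 1).2 := hs
  have A2 : (e.area 2).1 ≤ r * Real.sqrt (1 + 2 * r) ∧
      r * Real.sqrt (1 + 2 * r) ≤ (e.area 2).2 :=
    ⟨mul_le_mul hr.1 ht.1 p2 hr0.le, mul_le_mul hr.2 ht.2 (Real.sqrt_nonneg _) (hr0.le.trans hr.2)⟩
  have A3 : (e.area 3).1 ≤ r ^ 2 * Real.sqrt 3 ∧ r ^ 2 * Real.sqrt 3 ≤ (e.area 3).2 :=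
    ⟨mul_le_mul (pow_le_pow_left₀ p1 hr.1 2) A0.1 (by norm_num) (sq_nonneg r),
      mul_le_mul (pow_le_pow_left₀ hr0.le hr.2 2) A0.2 (Real.sqrt_nonneg _) (sq_nonneg _)⟩
  have C0 : (e.cov 0).1 ≤ Real.pi / 2 ∧ Real.pi / 2 ≤ (e.cov 0).2 := by
    simp only [Enclosure.cov]
    constructor <;> linarith [hp.1, hp.2]
  have C1 := mem_cov_bounds p1 p3 hr.1 hr.2 hg.1 hg.2 C0.1 C0.2
  have C2 := mem_cov_bounds p1 p4 hr.1 hr.2 hh.1 hh.2 C0.1 C0.2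
  have C3 : (e.cov 3).1 ≤ r ^ 2 * (Real.pi / 2) ∧ r ^ 2 * (Real.pi / 2) ≤ (e.cov 3).2 :=
    ⟨mul_le_mul (pow_le_pow_left₀ p1 hr.1 2) C0.1 (by norm_num) (sq_nonneg r),
      mul_le_mul (pow_le_pow_left₀ hr0.le hr.2 2) C0.2 (by positivity) (sq_nonneg _)⟩
  have C1' : (e.cov 1).1 ≤ tightCov 1 1 r ∧ tightCov 1 1 r ≤ (e.cov 1).2 := by
    rw [tightCov_one_one_r hr0]; exact C1
  have C2' : (e.cov 2).1 ≤ tightCov 1 r r ∧ tightCov 1 r r ≤ (e.cov 2).2 := by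
    rw [tightCov_one_r_r hr0]; exact C2
  rw [← one_mul (Real.pi / 2), ← one_pow 2, ← tightCov_self one_pos] at C0
  rw [← tightCov_self hr0] at C3
  rw [← one_mul (Real.sqrt 3), ← one_pow 2, ← tightArea_self one_pos] at A0
  rw [← tightArea_one_one_r] at A1
  rw [← tightArea_one_r_r hr0] at A2
  rw [← tightArea_self hr0] at A3
  clear C1 C2
  have hA : 0 < targetSum i r tightArea := by
    have := p6.trans_le A0.1
    have := p7.trans_le A1.1
    have := p8.trans_le A2.1
    have := p9.trans_le A3.1
    unfold targetSum targetCount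
    split <;> simp only <;> linarith
  have hδ : (e.d - 60 : ℝ) / 10 ^ 12 ≤ targetDensity i r ∧
      targetDensity i r ≤ (e.d + 60 : ℝ) / 10 ^ 12 := by
    have hd : 0 ≤ (e.d + 60 : ℝ) / 10 ^ 12 := p5.trans (by gcongr; linarith)
    rw [targetDensity, le_div_iff₀ hA, div_le_iff₀ hA]
    unfold targetSum
    constructor
    · refine le_trans (mul_le_mul_of_nonneg_left ?_ p5) (hcheck.1.trans ?_)
      · gcongr
        exacts [A0.2, A1.2, A2.2, A3.2]
      · gcongr
        exacts [C0.1, C1'.1, C2'.1, C3.1]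
    · refine le_trans ?_ (hcheck.2.trans (mul_le_mul_of_nonneg_left ?_ hd))
      · gcongr
        exacts [C0.2, C1'.2, C2'.2, C3.2]
      · gcongr
        exacts [A0.1, A1.1, A2.1, A3.1]
  exact ⟨mem_excess_bounds p5 p6.le hδ A0 C0 (hfinal 0).1 (hfinal 0).2,
    mem_excess_bounds p5 p7.le hδ A1 C1' (hfinal 1).1 (hfinal 1).2,
    mem_excess_bounds p5 p8.le hδ A2 C2' (hfinal 2).1 (hfinal 2).2,
    mem_excess_bounds p5 p9.le hδ A3 C3 (hfinal 3).1 (hfinal 3).2⟩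

/-! ### Coronas -/

/-- Bounds, in units of `10⁻¹² / 6`, for the potential and the angle in a corner. -/
structure CornerBounds where
  pot : ℤ
  lo : ℤ
  hi : ℤ

/-- The inequality for the corona with `n₁`, `n₂`, `n₃` corners of the given kinds, in integers;
`μ` is the coefficient of the deviation, in units of `10⁻⁶`. -/
def CoronaIneq (c₁ c₂ c₃ : CornerBounds) (μ n₁ n₂ n₃ : ℤ) : Prop :=
  -- Either the potentials suffice alone, or the absolute value of the deviation is bounded below by
  -- one of its two signs. In these units `2π` is `12 * 10¹² π`, with `π` rounded down or up
  -- according to the sign.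
  0 ≤ n₁ * c₁.pot + n₂ * c₂.pot + n₃ * c₃.pot ∨
    0 ≤ 10 ^ 6 * (n₁ * c₁.pot + n₂ * c₂.pot + n₃ * c₃.pot)
      + μ * (12 * 3141592653589 - (n₁ * c₁.hi + n₂ * c₂.hi + n₃ * c₃.hi)) ∨
    0 ≤ 10 ^ 6 * (n₁ * c₁.pot + n₂ * c₂.pot + n₃ * c₃.pot)
      + μ * ((n₁ * c₁.lo + n₂ * c₂.lo + n₃ * c₃.lo) - 12 * 3141592653590)

instance (c₁ c₂ c₃ : CornerBounds) (μ n₁ n₂ n₃ : ℤ) : Decidable (CoronaIneq c₁ c₂ c₃ μ n₁ n₂ n₃) :=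
  inferInstanceAs (Decidable (_ ∨ _ ∨ _))

/-- The coronas with at least `n` corners of a given kind satisfy the inequality. -/
def CornerBounds.Tail (c : CornerBounds) (μ n : ℤ) : Prop :=
  -- Each corner contributes a nonnegative amount of potential plus `μ` times angle, and `n` of them
  -- outweigh `μ` times `2π`.
  0 ≤ 10 ^ 6 * c.pot + μ * c.lo ∧
    μ * (12 * 3141592653590) ≤ n * (10 ^ 6 * c.pot + μ * c.lo)

instance (c : CornerBounds) (μ n : ℤ) : Decidable (c.Tail μ n) :=
  inferInstanceAs (Decidable (_ ∧ _))

/-- All coronas, with the exception of `ex`, satisfy the inequality; the number of corners of the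
second kind is even. -/
def CoronaCheck (c₁ c₂ c₃ : CornerBounds) (μ : ℤ) (ex : ℕ × ℕ × ℕ) : Prop :=
  -- The tail thresholds 7, 10 and 13 delimit the finite box. As the second number is even, it is
  -- written `2 * n₂` with `n₂ < 5`.
  0 ≤ μ ∧ c₁.Tail μ 7 ∧ c₂.Tail μ 10 ∧ c₃.Tail μ 13 ∧
    ∀ n₁ < 7, ∀ n₂ < 5, ∀ n₃ < 13, (n₁, 2 * n₂, n₃) = ex ∨
      CoronaIneq c₁ c₂ c₃ μ n₁ (2 * n₂ : ℕ) n₃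

instance (c₁ c₂ c₃ : CornerBounds) (μ : ℤ) (ex : ℕ × ℕ × ℕ) :
    Decidable (CoronaCheck c₁ c₂ c₃ μ ex) :=
  inferInstanceAs (Decidable (_ ∧ _ ∧ _ ∧ _ ∧ _))

/-- `c` bounds the potential `V` from below and the angle `θ` from both sides. -/
structure CornerBounds.Bounds (c : CornerBounds) (V θ : ℝ) : Prop where
  pot : (c.pot : ℝ) ≤ 6 * 10 ^ 12 * V
  lo : (c.lo : ℝ) ≤ 6 * 10 ^ 12 * θ
  hi : 6 * 10 ^ 12 * θ ≤ (c.hi : ℝ)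

/-- Outside the box, one tail alone yields the third alternative of `CoronaIneq`, since the other
two kinds of corners contribute nonnegative amounts. -/
theorem CoronaCheck.coronaIneq {c₁ c₂ c₃ : CornerBounds} {μ : ℤ} {ex : ℕ × ℕ × ℕ}
    (h : CoronaCheck c₁ c₂ c₃ μ ex) {n₁ n₂ n₃ : ℕ} (he : Even n₂) (hne : (n₁, n₂, n₃) ≠ ex) :
    CoronaIneq c₁ c₂ c₃ μ n₁ n₂ n₃ := by
  obtain ⟨hμ, ⟨a1, b1⟩, ⟨a2, b2⟩, ⟨a3, b3⟩, hbox⟩ := h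
  have key : (n₁ * (10 ^ 6 * c₁.pot + μ * c₁.lo)
      + n₂ * (10 ^ 6 * c₂.pot + μ * c₂.lo) + n₃ * (10 ^ 6 * c₃.pot + μ * c₃.lo) : ℤ)
        ≥ μ * (12 * 3141592653590) → CoronaIneq c₁ c₂ c₃ μ n₁ n₂ n₃ := by
    intro hk
    right
    right
    linarith
  have m1 : 0 ≤ (n₁ : ℤ) * (10 ^ 6 * c₁.pot + μ * c₁.lo) := by positivity
  have m2 : 0 ≤ (n₂ : ℤ) * (10 ^ 6 * c₂.pot + μ * c₂.lo) := by positivity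
  have m3 : 0 ≤ (n₃ : ℤ) * (10 ^ 6 * c₃.pot + μ * c₃.lo) := by positivity
  obtain ⟨l, rfl⟩ := he
  by_cases h1 : n₁ < 7
  · by_cases h2 : l < 5
    · by_cases h3 : n₃ < 13
      · rcases hbox n₁ h1 l h2 n₃ h3 with h | h
        · exact absurd (by rw [← h, two_mul]) hne
        · rwa [two_mul] at h
      · have : (13 : ℤ) ≤ n₃ := by exact_mod_cast not_lt.1 h3
        have := mul_le_mul_of_nonneg_right this a3
        exact key (by linarith)
    · have : (10 : ℤ) ≤ (l + l : ℕ) := by push_cast; omega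
      have := mul_le_mul_of_nonneg_right this a2
      exact key (by linarith)
  · have : (7 : ℤ) ≤ n₁ := by exact_mod_cast not_lt.1 h1
    have := mul_le_mul_of_nonneg_right this a1
    exact key (by linarith)

theorem CoronaIneq.nonneg {c₁ c₂ c₃ : CornerBounds} {μ : ℤ} {n₁ n₂ n₃ : ℕ}
    (h : CoronaIneq c₁ c₂ c₃ μ n₁ n₂ n₃) (hμ : 0 ≤ μ) {V₁ V₂ V₃ θ₁ θ₂ θ₃ : ℝ}
    (h₁ : c₁.Bounds V₁ θ₁) (h₂ : c₂.Bounds V₂ θ₂) (h₃ : c₃.Bounds V₃ θ₃) :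
    0 ≤ n₁ * V₁ + n₂ * V₂ + n₃ * V₃
      + μ / 10 ^ 6 * |2 * Real.pi - (n₁ * θ₁ + n₂ * θ₂ + n₃ * θ₃)| := by
  obtain ⟨p1, p2⟩ := pi_near
  have k1 : (0 : ℝ) ≤ n₁ := Nat.cast_nonneg _
  have k2 : (0 : ℝ) ≤ n₂ := Nat.cast_nonneg _
  have k3 : (0 : ℝ) ≤ n₃ := Nat.cast_nonneg _
  have hμ' : (0 : ℝ) ≤ μ := by exact_mod_cast hμ
  have hV : (n₁ * c₁.pot + n₂ * c₂.pot + n₃ * c₃.pot : ℝ)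
      ≤ 6 * 10 ^ 12 * (n₁ * V₁ + n₂ * V₂ + n₃ * V₃) := by
    have := mul_le_mul_of_nonneg_left h₁.pot k1
    have := mul_le_mul_of_nonneg_left h₂.pot k2
    have := mul_le_mul_of_nonneg_left h₃.pot k3
    linarith
  have hlo : (n₁ * c₁.lo + n₂ * c₂.lo + n₃ * c₃.lo : ℝ)
      ≤ 6 * 10 ^ 12 * (n₁ * θ₁ + n₂ * θ₂ + n₃ * θ₃) := by
    have := mul_le_mul_of_nonneg_left h₁.lo k1
    have := mul_le_mul_of_nonneg_left h₂.lo k2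
    have := mul_le_mul_of_nonneg_left h₃.lo k3
    linarith
  have hhi : 6 * 10 ^ 12 * (n₁ * θ₁ + n₂ * θ₂ + n₃ * θ₃)
      ≤ (n₁ * c₁.hi + n₂ * c₂.hi + n₃ * c₃.hi : ℝ) := by
    have := mul_le_mul_of_nonneg_left h₁.hi k1
    have := mul_le_mul_of_nonneg_left h₂.hi k2
    have := mul_le_mul_of_nonneg_left h₃.hi k3
    linarith
  set X := n₁ * V₁ + n₂ * V₂ + n₃ * V₃
  set Y := n₁ * θ₁ + n₂ * θ₂ + n₃ * θ₃
  rcases h with h | h | h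
  · have h' : (0 : ℝ) ≤ n₁ * c₁.pot + n₂ * c₂.pot + n₃ * c₃.pot := by exact_mod_cast h
    have : 0 ≤ X := by linarith
    positivity
  · have h' : (0 : ℝ) ≤ 10 ^ 6 * (n₁ * c₁.pot + n₂ * c₂.pot + n₃ * c₃.pot)
      + μ * (12 * 3141592653589 - (n₁ * c₁.hi + n₂ * c₂.hi + n₃ * c₃.hi)) := by exact_mod_cast h
    have e1 := mul_le_mul_of_nonneg_left (le_abs_self (2 * Real.pi - Y)) hμ'
    have e2 : μ * (12 * 3141592653589 - (n₁ * c₁.hi + n₂ * c₂.hi + n₃ * c₃.hi) : ℝ)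
        ≤ μ * (6 * 10 ^ 12 * (2 * Real.pi - Y)) :=
      mul_le_mul_of_nonneg_left (by linarith) hμ'
    linarith
  · have h' : (0 : ℝ) ≤ 10 ^ 6 * (n₁ * c₁.pot + n₂ * c₂.pot + n₃ * c₃.pot)
      + μ * ((n₁ * c₁.lo + n₂ * c₂.lo + n₃ * c₃.lo) - 12 * 3141592653590) := by exact_mod_cast h
    have e1 := mul_le_mul_of_nonneg_left (neg_le_abs (2 * Real.pi - Y)) hμ'
    have e2 : μ * ((n₁ * c₁.lo + n₂ * c₂.lo + n₃ * c₃.lo) - 12 * 3141592653590 : ℝ)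
        ≤ μ * (6 * 10 ^ 12 * (-(2 * Real.pi - Y))) :=
      mul_le_mul_of_nonneg_left (by linarith) hμ'
    linarith

/-- A lower bound for the potential at the centre of the disc `q` in a tight triangle with discs
`x`, `q`, `y`, except at a singular disc. -/
noncomputable def basePotentialBound (i : ℕ) (r : ℝ) (x q y : DiscType) : ℝ :=
  -- For `i = 5`, zero is a lower bound for the share of the excess at a regular disc, see
  -- `basePotentialBound_le`.
  if i = 5 ∧ x = small ∧ q = small ∧ y = small then 0 else tightPotential i r x q y

/-- A lower bound for `6 V_{11r}` in units of `10⁻¹²`. -/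
def potLLS (i : ℕ) : ℤ :=
  match i with
  | 2 => -((enclosure 2).e₀ + 200)
  | 6 => 3 * ((enclosure 6).e₁ - 200)
  | _ => 0

/-- The bounds in the corners of a disc `q` between two large discs. -/
def cornerLL (i : ℕ) (q : DiscType) : CornerBounds :=
  match q with
  | large => ⟨2 * ((enclosure i).e₀ - 200), 2 * 3141592653589, 2 * 3141592653590⟩
  -- `V_{1r1} = E_{11r} - 2 V_{11r}`, where `V_{11r}` is `-E_{111} / 6` for `i = 2`, `E_{11r} / 2`
  -- for `i = 6`, and zero otherwise.
  | small => ⟨match i with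
      | 2 => 6 * ((enclosure 2).e₁ - 200) + 2 * ((enclosure 2).e₀ - 200)
      | 6 => 0
      | i => 6 * ((enclosure i).e₁ - 200),
      6 * 3141592653589 - 12 * ((enclosure i).g + 4),
      6 * 3141592653590 - 12 * ((enclosure i).g - 4)⟩

/-- The bounds in the corners of a disc `q` between a large and a small disc. -/
def cornerLS (i : ℕ) (q : DiscType) : CornerBounds :=
  match q with
  | large => ⟨potLLS i, 6 * ((enclosure i).g - 4), 6 * ((enclosure i).g + 4)⟩
  | small => ⟨3 * ((enclosure i).e₂ - 200), 3 * 3141592653589 - 6 * ((enclosure i).h + 4),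
      3 * 3141592653590 - 6 * ((enclosure i).h - 4)⟩

/-- The bounds in the corners of a disc `q` between two small discs. -/
def cornerSS (i : ℕ) (q : DiscType) : CornerBounds :=
  match q with
  | large => ⟨0, 12 * ((enclosure i).h - 4), 12 * ((enclosure i).h + 4)⟩
  | small => ⟨match i with
      | 5 => 0
      | i => 2 * ((enclosure i).e₃ - 200), 2 * 3141592653589, 2 * 3141592653590⟩

/-- The tabulated lower bounds on `m_1` and `m_r`, in units of `10⁻⁶`. -/
def microBound (i : ℕ) (q : DiscType) : ℤ :=
  match i, q with
  | 1, small => 500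
  | 2, large => 160000
  | 2, small => 87000
  | 3, small => 280
  | 4, small => 2100
  | 5, small => 48000
  | 6, large => 9100
  | 6, small => 2100
  | 7, small => 1100
  | 8, small => 2000
  | 9, small => 2058
  | _, _ => 0

/-- The numbers of corners `(1,1)`, `(1,r)` and `(r,r)` around a disc of the target packing. -/
def targetCorona (i : ℕ) (q : DiscType) : ℕ × ℕ × ℕ :=
  match i, q with
  | 1, large => (0, 6, 1)
  | 2, large => (2, 4, 1)
  | 3, large => (0, 4, 4)
  | 4, large => (0, 8, 0)
  | 5, large => (0, 6, 3)
  | 6, large => (0, 0, 12)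
  | 7, large => (0, 8, 2)
  | 8, large => (0, 12, 0)
  | 9, large => (0, 12, 6)
  | 1, small => (3, 2, 0)
  | 2, small => (2, 2, 1)
  | 3, small => (1, 4, 0)
  | 4, small => (4, 0, 0)
  | 5, small => (1, 2, 2)
  | 6, small => (0, 4, 1)
  | 7, small => (2, 2, 0)
  | 8, small => (3, 0, 0)
  | 9, small => (1, 2, 1)
  | _, _ => (0, 0, 0)

theorem mLowerBound_eq (i : ℕ) (q : DiscType) : mLowerBound i q = microBound i q / 10 ^ 6 := by
  unfold mLowerBound microBound
  split <;> norm_num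

/-- The finite computation: for each radius and each kind of central disc, three tail conditions and
a box of `7 * 5 * 13` triples. -/
theorem coronaCheck {i : ℕ} (hi : i ∈ Set.Icc 1 9) (q : DiscType) :
    CoronaCheck (cornerLL i q) (cornerLS i q) (cornerSS i q) (microBound i q)
      (targetCorona i q) := by
  obtain ⟨h1, h9⟩ := hi
  cases q <;> interval_cases i <;> decide +kernel

/-- Equality is attained at the target corona, so approximations cannot decide it; the sum vanishes
by the equations that define the potentials. The small disc of case 5 is excluded because its
equation uses `E_rrr / 2` in place of `V_{rrr}`. -/
theorem target_sum_eq_zero {i : ℕ} (hi : i ∈ Set.Icc 1 9) {r : ℝ} (hr : 0 < r) (q : DiscType)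
    (hq : ¬ (i = 5 ∧ q = small)) :
    (targetCorona i q).1 * tightPotential i r large q large
      + (targetCorona i q).2.1 * tightPotential i r large q small
      + (targetCorona i q).2.2 * tightPotential i r small q small = 0 := by
  have h := (isTightPotential_iff i hi r hr _).2 rfl
  have hs := h.smallEq
  have hl := h.largeEq
  have c1 := h.symm small small large
  have c2 := h.symm small large large
  obtain ⟨h1, h9⟩ := hi
  clear h
  cases q <;> interval_cases i <;>
    first
    | exact absurd ⟨rfl, rfl⟩ hq
    | simp only [smallCorona, largeCorona, targetCorona] at hs hl ⊢
      push_cast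
      linarith

theorem corner_bounds {i : ℕ} (hi : i ∈ Set.Icc 1 9) {r : ℝ} (hr : IsTargetRadius i r)
    (hr0 : 0 < r) (q : DiscType) :
    (cornerLL i q).Bounds (basePotentialBound i r large q large)
      (tightAngle 1 (q.radius r) 1) ∧
    (cornerLS i q).Bounds (basePotentialBound i r large q small)
      (tightAngle 1 (q.radius r) r) ∧
    (cornerSS i q).Bounds (basePotentialBound i r small q small)
      (tightAngle r (q.radius r) r) := by
  have hn := radius_near hi hr
  obtain ⟨-, -, hg, hh⟩ := inputs_near hi hn
  obtain ⟨e0, e1, e2, e3⟩ := excess_near hi hr0 hn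
  obtain ⟨p1, p2⟩ := pi_near
  unfold Near at *
  push_cast at *
  rw [one_div] at hg
  have hLLS : (potLLS i : ℝ) ≤ 6 * 10 ^ 12 * tightPotentialLLS i r := by
    unfold potLLS tightPotentialLLS
    split <;> push_cast <;> linarith
  have hLL : ((cornerLL i small).pot : ℝ)
      ≤ 6 * 10 ^ 12 * (tightExcess i r large large small - 2 * tightPotentialLLS i r) := by
    unfold cornerLL tightPotentialLLS
    dsimp only
    split <;> push_cast <;> linarith
  have hSS : ((cornerSS i small).pot : ℝ)
      ≤ 6 * 10 ^ 12 * basePotentialBound i r small small small := by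
    unfold cornerSS basePotentialBound
    dsimp only
    split
    · simp
    · rename_i h5
      rw [if_neg (fun h => h5 h.1)]
      simp only [tightPotential]
      push_cast
      linarith
  cases q
  · refine ⟨⟨?_, ?_, ?_⟩, ⟨?_, ?_, ?_⟩, ⟨?_, ?_, ?_⟩⟩ <;>
      simp [cornerLL, cornerLS, cornerSS, basePotentialBound, tightPotential, DiscType.radius,
        tightAngle_self one_pos, tightAngle_one_one hr0, tightAngle_r_one_r hr0] <;> linarith
  · refine ⟨⟨?_, ?_, ?_⟩, ⟨?_, ?_, ?_⟩, ⟨hSS, ?_, ?_⟩⟩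
    · simpa [basePotentialBound, tightPotential] using hLL
    all_goals
      simp [cornerLL, cornerLS, cornerSS, basePotentialBound, tightPotential, DiscType.radius,
        tightAngle_self hr0, tightAngle_one_r_one hr0, tightAngle_one_r_r hr0]
      linarith

/-- The corona inequality, with the exception of the corona of a singular disc. -/
theorem corona_nonneg {i : ℕ} (hi : i ∈ Set.Icc 1 9) {r : ℝ} (hr : IsTargetRadius i r)
    (hr0 : 0 < r) (q : DiscType) {n₁ n₂ n₃ : ℕ} (he : Even n₂)
    (hne : ¬ (i = 5 ∧ q = small ∧ (n₁, n₂, n₃) = (1, 2, 2))) :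
    0 ≤ n₁ * basePotentialBound i r large q large + n₂ * basePotentialBound i r large q small
      + n₃ * basePotentialBound i r small q small
      + mLowerBound i q * |2 * Real.pi - (n₁ * tightAngle 1 (q.radius r) 1
        + n₂ * tightAngle 1 (q.radius r) r + n₃ * tightAngle r (q.radius r) r)| := by
  have hc := coronaCheck hi q
  obtain ⟨b1, b2, b3⟩ := corner_bounds hi hr hr0 q
  rw [mLowerBound_eq]
  by_cases hex : (n₁, n₂, n₃) = targetCorona i q
  · have hq : ¬ (i = 5 ∧ q = small) := by
      rintro ⟨rfl, rfl⟩
      exact hne ⟨rfl, rfl, hex⟩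
    have h0 := target_sum_eq_zero hi hr0 q hq
    rw [← hex] at h0
    have hV : ∀ x y, basePotentialBound i r x q y = tightPotential i r x q y := fun x y =>
      if_neg fun h => hq ⟨h.1, h.2.2.1⟩
    rw [hV, hV, hV, h0, zero_add]
    have : (0 : ℝ) ≤ microBound i q := by exact_mod_cast hc.1
    positivity
  · exact (hc.coronaIneq he hex).nonneg hc.1 b1 b2 b3

/-! ### Counting corners in cyclic sequences of discs -/

/-- The corners of a walk through disc kinds, counted by their kinds. -/
theorem exists_corner_count (k : ℕ → DiscType) (n : ℕ) : ∃ n₁ n₂ n₃ : ℕ, n₁ + n₂ + n₃ = n ∧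
    (Even n₂ ↔ k n = k 0) ∧ ∀ f : DiscType → DiscType → ℝ, (∀ x y, f x y = f y x) →
      ∑ j ∈ Finset.range n, f (k j) (k (j + 1))
        = n₁ * f large large + n₂ * f large small + n₃ * f small small := by
  induction n with
  | zero => exact ⟨0, 0, 0, by simp⟩
  | succ n ih =>
    obtain ⟨n₁, n₂, n₃, h1, h2, h3⟩ := ih
    -- Only a mixed corner changes the kind, and only it flips the parity of `n₂`.
    rcases hn : k n with _ | _ <;> rcases hn' : k (n + 1) with _ | _ <;> rw [hn] at h2
    · refine ⟨n₁ + 1, n₂, n₃, by omega, h2, fun f hf => ?_⟩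
      rw [Finset.sum_range_succ, h3 f hf, hn, hn']
      push_cast
      ring
    · refine ⟨n₁, n₂ + 1, n₃, by omega, ?_, fun f hf => ?_⟩
      · rw [Nat.even_add_one, h2]
        cases k 0 <;> simp
      · rw [Finset.sum_range_succ, h3 f hf, hn, hn']
        push_cast
        ring
    · refine ⟨n₁, n₂ + 1, n₃, by omega, ?_, fun f hf => ?_⟩
      · rw [Nat.even_add_one, h2]
        cases k 0 <;> simp
      · rw [Finset.sum_range_succ, h3 f hf, hn, hn', hf small large]
        push_cast
        ring
    · refine ⟨n₁, n₂, n₃ + 1, by omega, h2, fun f hf => ?_⟩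
      rw [Finset.sum_range_succ, h3 f hf, hn, hn']
      push_cast
      ring

/-- A cyclic sequence of five discs with one pair of consecutive large discs and two pairs of
consecutive small ones is, up to a rotation, `large, large, small, small, small`. -/
theorem exists_rotation (k : ℕ → DiscType) (hper : ∀ j, k (j + 5) = k j)
    (hl : ∑ j ∈ Finset.range 5, (if k j = large ∧ k (j + 1) = large then 1 else 0 : ℝ) = 1)
    (hs : ∑ j ∈ Finset.range 5, (if k j = small ∧ k (j + 1) = small then 1 else 0 : ℝ) = 2) :
    ∃ s, k s = large ∧ k (s + 1) = large ∧ k (s + 2) = small ∧ k (s + 3) = small ∧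
      k (s + 4) = small := by
  have p0 := hper 0
  have p1 := hper 1
  have p2 := hper 2
  have p3 := hper 3
  simp only [Finset.sum_range_succ, Finset.sum_range_zero, zero_add, Nat.reduceAdd] at *
  -- These are the five rotations of the pattern; every other sequence of five kinds violates one of
  -- the two counts.
  by_cases c0 : k 0 = large ∧ k 1 = large ∧ k 2 = small ∧ k 3 = small ∧ k 4 = small
  · exact ⟨0, c0⟩
  by_cases c1 : k 1 = large ∧ k 2 = large ∧ k 3 = small ∧ k 4 = small ∧ k 0 = small
  · exact ⟨1, by simpa [p0] using c1⟩
  by_cases c2 : k 2 = large ∧ k 3 = large ∧ k 4 = small ∧ k 0 = small ∧ k 1 = small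
  · exact ⟨2, by simpa [p0, p1] using c2⟩
  by_cases c3 : k 3 = large ∧ k 4 = large ∧ k 0 = small ∧ k 1 = small ∧ k 2 = small
  · exact ⟨3, by simpa [p0, p1, p2] using c3⟩
  by_cases c4 : k 4 = large ∧ k 0 = large ∧ k 1 = small ∧ k 2 = small ∧ k 3 = small
  · exact ⟨4, by simpa [p0, p1, p2, p3] using c4⟩
  exfalso
  have ne : large ≠ small := nofun
  rw [p0] at hl hs
  clear hper p0 p1 p2 p3
  generalize k 0 = a at *
  generalize k 1 = b at *
  generalize k 2 = c at *
  generalize k 3 = d at *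
  generalize k 4 = e at *
  cases a <;> cases b <;> cases c <;> cases d <;> cases e <;>
    first
    | (refine absurd hl ?_; norm_num [ne, ne.symm]; done)
    | (refine absurd hs ?_; norm_num [ne, ne.symm]; done)
    | simp [*] at c0 c1 c2 c3 c4

theorem mLowerBound_nonneg {i : ℕ} (hi : i ∈ Set.Icc 1 9) (q : DiscType) :
    0 ≤ mLowerBound i q := by
  rw [mLowerBound_eq]
  have : (0 : ℝ) ≤ microBound i q := by exact_mod_cast (coronaCheck hi q).1
  positivity

namespace DiscPacking

variable {r : ℝ} {P : DiscPacking r} {𝒯 : Set (Finset Plane)} {v : Plane}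

/-! ### From coronas to vertex sums -/

/-- The neighbours of `v`, in cyclic order, are `w 0, …, w (n - 1)`. -/
structure IsCycle (𝒯 : Set (Finset Plane)) (v : Plane) (n : ℕ) (w : ℕ → Plane) : Prop where
  eq_iff : ∀ i j, w i = w j ↔ i ≡ j [MOD n]
  mem_star : ∀ T, T ∈ star 𝒯 v ↔ ∃ j, T = {v, w j, w (j + 1)}

theorem IsCycle.add_period {n : ℕ} {w : ℕ → Plane} (hw : IsCycle 𝒯 v n w) (j : ℕ) :
    w (j + n) = w j :=
  (hw.eq_iff _ _).2 (by simp [Nat.ModEq])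

theorem IsCycle.shift {n : ℕ} {w : ℕ → Plane} (hw : IsCycle 𝒯 v n w) (hn : 0 < n) (s : ℕ) :
    IsCycle 𝒯 v n fun j => w (s + j) := by
  refine ⟨fun i j => ?_, fun T => ?_⟩
  · rw [hw.eq_iff]
    exact ⟨fun h => Nat.ModEq.add_left_cancel' s h, fun h => h.add_left s⟩
  · rw [hw.mem_star]
    constructor
    · rintro ⟨j, rfl⟩
      -- Adding `s * (n - 1)` replaces subtracting `s`, modulo `n`.
      have e : j + s * n = s + (j + s * (n - 1)) := by
        obtain ⟨m, rfl⟩ := Nat.exists_eq_succ_of_ne_zero hn.ne'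
        simp
        ring
      refine ⟨j + s * (n - 1), ?_⟩
      rw [show s + (j + s * (n - 1) + 1) = j + s * n + 1 by omega, ← e,
        (hw.eq_iff (j + s * n) j).2 (by simp [Nat.ModEq]),
        (hw.eq_iff (j + s * n + 1) (j + 1)).2
          (Nat.ModEq.add_right 1 (by simp [Nat.ModEq]))]
    · rintro ⟨j, rfl⟩
      exact ⟨s + j, by rw [add_assoc]⟩

theorem IsFMTriangulation.exists_isCycle (h : P.IsFMTriangulation 𝒯) (hP : P.Saturated)
    (hr : 0 < r) (hv : v ∈ P.centers) :
    ∃ n : ℕ, 3 ≤ n ∧ ∃ w : ℕ → Plane, IsCycle 𝒯 v n w ∧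
      ∑ j ∈ Finset.range n, EuclideanGeometry.angle (w j) v (w (j + 1)) = 2 * Real.pi := by
  obtain ⟨n, hn, w, hper, hinj, hstar, hsum⟩ := h.exists_cycle hP hr hv
  have hmod : ∀ j, w (j % n) = w j := fun j => Function.Periodic.map_mod_nat hper j
  refine ⟨n, hn, w, ⟨fun i j => ⟨fun hij => ?_, fun hij => ?_⟩, fun T => ?_⟩, hsum⟩
  · rw [← hmod i, ← hmod j] at hij
    exact hinj (Nat.mod_lt _ (by omega)) (Nat.mod_lt _ (by omega)) hij
  · rw [← hmod i, ← hmod j, hij]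
  · rw [hstar]
    constructor
    · rintro ⟨j, -, rfl⟩
      exact ⟨j, rfl⟩
    · rintro ⟨j, rfl⟩
      refine ⟨j % n, Nat.mod_lt _ (by omega), ?_⟩
      rw [hmod, ← hmod (j % n + 1), Nat.mod_add_mod, hmod]

theorem ne_of_card_eq_three {a b c : Plane} (h : ({a, b, c} : Finset Plane).card = 3) :
    a ≠ b ∧ a ≠ c ∧ b ≠ c := by
  refine ⟨?_, ?_, ?_⟩ <;> rintro rfl
  · rw [Finset.insert_eq_of_mem (by simp)] at h
    have := Finset.card_le_two (a := a) (b := c)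
    omega
  · rw [Finset.insert_eq_of_mem (by simp)] at h
    have := Finset.card_le_two (a := b) (b := a)
    omega
  · rw [Finset.pair_eq_singleton] at h
    have := Finset.card_le_two (a := a) (b := b)
    omega

theorem IsFMTriangulation.sum_star (h : P.IsFMTriangulation 𝒯) {n : ℕ} (hn : 3 ≤ n)
    {w : ℕ → Plane} (hw : IsCycle 𝒯 v n w) (hfin : (star 𝒯 v).Finite) (i : ℕ)
    (m : DiscType → ℝ) :
    ∑ T ∈ hfin.toFinset, P.vertexPotential i 𝒯 m v T = ∑ j ∈ Finset.range n,
      P.cornerPotential i 𝒯 m {v, w j, w (j + 1)} (w j) v (w (j + 1)) := by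
  have hne : ∀ j, v ≠ w j ∧ v ≠ w (j + 1) ∧ w j ≠ w (j + 1) := fun j =>
    ne_of_card_eq_three (h.card_eq _ ((hw.mem_star _).2 ⟨j, rfl⟩).1)
  have himg : hfin.toFinset
      = (Finset.range n).image fun j => ({v, w j, w (j + 1)} : Finset Plane) := by
    ext T
    rw [Set.Finite.mem_toFinset, hw.mem_star, Finset.mem_image]
    constructor
    · rintro ⟨j, rfl⟩
      refine ⟨j % n, Finset.mem_range.2 (Nat.mod_lt _ (by omega)), ?_⟩
      rw [(hw.eq_iff (j % n) j).2 (Nat.mod_modEq _ _),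
        (hw.eq_iff (j % n + 1) (j + 1)).2 ((Nat.mod_modEq _ _).add_right 1)]
    · rintro ⟨j, -, rfl⟩
      exact ⟨j, rfl⟩
  rw [himg, Finset.sum_image]
  · exact Finset.sum_congr rfl fun j _ =>
      vertexPotential_eq i P 𝒯 m v _ _ (hne j).1 (hne j).2.1 (hne j).2.2
  · intro j hj k hk hjk
    rw [Finset.mem_coe, Finset.mem_range] at hj hk
    dsimp only at hjk
    have h1 : w j ∈ ({v, w k, w (k + 1)} : Finset Plane) := by rw [← hjk]; simp
    have h2 : w (j + 1) ∈ ({v, w k, w (k + 1)} : Finset Plane) := by rw [← hjk]; simp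
    simp only [Finset.mem_insert, Finset.mem_singleton, (hne j).1.symm, (hne j).2.1.symm,
      false_or, hw.eq_iff] at h1 h2
    rcases h1 with h1 | h1
    · exact h1.eq_of_lt_of_lt hj hk
    · rcases h2 with h2 | h2
      -- The same triangle traversed in the opposite direction would give `n ∣ 2`, excluded by `3 ≤
      -- n`.
      · exfalso
        have h3 : k + 2 ≡ k + 0 [MOD n] := (h1.symm.add_right 1).trans h2
        have h4 := Nat.ModEq.add_left_cancel' k h3
        have := (Nat.modEq_zero_iff_dvd.1 h4)
        have := Nat.le_of_dvd (by norm_num) this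
        omega
      · exact (Nat.ModEq.add_right_cancel' 1 h2).eq_of_lt_of_lt hj hk

/-- The excess of three small discs is nonnegative if `i = 5`. -/
theorem tightExcess_sss_nonneg (hr : IsTargetRadius 5 r) (hr0 : 0 < r) :
    0 ≤ tightExcess 5 r small small small := by
  have h := (excess_near (i := 5) (by simp) hr0 (radius_near (by simp) hr)).2.2.2.1
  refine le_trans ?_ h
  norm_num [enclosure]

/-- As `v` is regular, at most two vertices of `T` are singular. So the remainder `E_rrr (1 - s /
2)` of the excess is nonnegative, and it is divided by `3 - s > 0`. -/
theorem basePotentialBound_le {i : ℕ} (hr : IsTargetRadius i r) (hr0 : 0 < r)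
    {T : Finset Plane} (hT : T.card = 3) (hv : v ∈ T) (hreg : i = 5 → ¬ P.IsSingular 𝒯 v)
    (a b : Plane) :
    basePotentialBound i r (P.kind a) (P.kind v) (P.kind b) ≤ P.basePotential i 𝒯 T a v b := by
  unfold basePotentialBound basePotential
  split_ifs with h
  · obtain ⟨rfl, -⟩ := h
    have hE := tightExcess_sss_nonneg hr hr0
    have hs : P.numSingular 𝒯 T ≤ 2 := by
      have : P.numSingular 𝒯 T < T.card :=
        Finset.card_lt_card (Finset.filter_ssubset.2 ⟨v, hv, hreg rfl⟩)
      omega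
    have hs' : (P.numSingular 𝒯 T : ℝ) ≤ 2 := by exact_mod_cast hs
    rw [smallTriplePotential, if_neg (hreg rfl)]
    apply div_nonneg
    · nlinarith
    · linarith
  · exact le_rfl

theorem basePotentialBound_comm (i : ℕ) (r : ℝ) (x q y : DiscType) :
    basePotentialBound i r x q y = basePotentialBound i r y q x := by
  unfold basePotentialBound
  cases x <;> cases q <;> cases y <;> simp [tightPotential]

/-- A small disc with one corner of two large discs, two mixed corners and two corners of two small
discs is singular. -/
theorem IsCycle.isSingular {w : ℕ → Plane} (hw : IsCycle 𝒯 v 5 w) (hv : P.kind v = small)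
    (h0 : P.kind (w 0) = large) (h1 : P.kind (w 1) = large) (h2 : P.kind (w 2) = small)
    (h3 : P.kind (w 3) = small) (h4 : P.kind (w 4) = small) : P.IsSingular 𝒯 v := by
  refine ⟨hv, fun j => w j, ?_, fun T => ?_, h0, h1, h2, h3, h4⟩
  · intro j k hjk
    exact Fin.ext ((hw.eq_iff _ _).1 hjk |>.eq_of_lt_of_lt j.2 k.2)
  · have hsucc : ∀ j : Fin 5, w (j + 1 : Fin 5) = w (j + 1 : ℕ) := by
      intro j
      rw [hw.eq_iff]
      fin_cases j <;> decide
    simp only [hsucc]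
    rw [hw.mem_star]
    constructor
    · rintro ⟨j, rfl⟩
      refine ⟨⟨j % 5, Nat.mod_lt _ (by norm_num)⟩, ?_⟩
      rw [(hw.eq_iff (j % 5) j).2 (Nat.mod_modEq _ _),
        (hw.eq_iff (j % 5 + 1) (j + 1)).2 ((Nat.mod_modEq _ _).add_right 1)]
      simp
    · rintro ⟨j, hj⟩
      refine ⟨j, ?_⟩
      apply Finset.coe_injective
      rw [hj]
      simp

theorem IsSingular.exists_isCycle (h : P.IsSingular 𝒯 v) : ∃ w : ℕ → Plane, IsCycle 𝒯 v 5 w ∧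
    P.kind (w 0) = large ∧ P.kind (w 1) = large ∧ P.kind (w 2) = small ∧
    P.kind (w 3) = small ∧ P.kind (w 4) = small := by
  obtain ⟨-, w, hinj, hstar, h0, h1, h2, h3, h4⟩ := h
  refine ⟨fun j => w (Fin.ofNat 5 j), ⟨fun i j => ?_, fun T => ?_⟩, h0, h1, h2, h3, h4⟩
  · rw [hinj.eq_iff, Fin.ext_iff]
    rfl
  · have hsucc : ∀ j : ℕ, Fin.ofNat 5 (j + 1) = Fin.ofNat 5 j + 1 := by
      intro j
      ext
      simp [Fin.ofNat, Fin.val_add]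
    rw [hstar]
    simp only [hsucc]
    constructor
    · rintro ⟨j, hj⟩
      refine ⟨j, ?_⟩
      apply Finset.coe_injective
      rw [hj]
      simp
    · rintro ⟨j, rfl⟩
      exact ⟨Fin.ofNat 5 j, by simp⟩

/-- The deviation terms are nonnegative, and without them the sum is exactly `smallCorona` for `i =
5`, which vanishes. -/
theorem sum_star_nonneg_of_isSingular (h : P.IsFMTriangulation 𝒯) (hr : 0 < r)
    (hfin : (star 𝒯 v).Finite) (hs : P.IsSingular 𝒯 v) {m : DiscType → ℝ} (hm : ∀ t, 0 ≤ m t) :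
    0 ≤ ∑ T ∈ hfin.toFinset, P.vertexPotential 5 𝒯 m v T := by
  obtain ⟨w, hw, h0, h1, h2, h3, h4⟩ := hs.exists_isCycle
  have h5 : w 5 = w 0 := hw.add_period 0
  have hle : ∀ j, P.basePotential 5 𝒯 {v, w j, w (j + 1)} (w j) v (w (j + 1))
      ≤ P.cornerPotential 5 𝒯 m {v, w j, w (j + 1)} (w j) v (w (j + 1)) := fun j =>
    le_add_of_nonneg_right (mul_nonneg (hm _) (abs_nonneg _))
  rw [h.sum_star (by norm_num) hw hfin]
  refine le_trans (le_of_eq ?_) (Finset.sum_le_sum fun j _ => hle j)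
  have hE := ((isTightPotential_iff 5 (by simp) r hr _).2 rfl).smallEq
  have hc := ((isTightPotential_iff 5 (by simp) r hr _).2 rfl).symm small small large
  simp only [smallCorona] at hE
  simp [Finset.sum_range_succ, basePotential, h0, h1, h2, h3, h4, h5, hs.1,
    smallTriplePotential, hs, hc]
  linarith

theorem sum_star_nonneg {i : ℕ} (hi : i ∈ Set.Icc 1 9) (hr : IsTargetRadius i r) (hr0 : 0 < r)
    (hP : P.Saturated) (h : P.IsFMTriangulation 𝒯) (hv : v ∈ P.centers)
    (hfin : (star 𝒯 v).Finite) (hreg : i = 5 → ¬ P.IsSingular 𝒯 v)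
    {m : DiscType → ℝ} (hm : ∀ t, mLowerBound i t ≤ m t) :
    0 ≤ ∑ T ∈ hfin.toFinset, P.vertexPotential i 𝒯 m v T := by
  obtain ⟨n, hn, w, hw, hsum⟩ := h.exists_isCycle hP hr0 hv
  rw [h.sum_star hn hw hfin]
  set q := P.kind v with hq
  set k : ℕ → DiscType := fun j => P.kind (w j) with hk
  obtain ⟨n₁, n₂, n₃, htotal, heven, hcount⟩ := exists_corner_count k n
  have hkn : k n = k 0 := by
    have := hw.add_period 0
    rw [zero_add] at this
    simp only [hk, this]
  have hμ := mLowerBound_nonneg hi q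
  set B : DiscType → DiscType → ℝ := fun x y => basePotentialBound i r x q y with hB
  set A : DiscType → DiscType → ℝ :=
    fun x y => tightAngle (x.radius r) (q.radius r) (y.radius r) with hA
  have hle : ∀ j, B (k j) (k (j + 1)) + mLowerBound i q
        * |EuclideanGeometry.angle (w j) v (w (j + 1)) - A (k j) (k (j + 1))|
      ≤ P.cornerPotential i 𝒯 m {v, w j, w (j + 1)} (w j) v (w (j + 1)) := by
    intro j
    have hT := h.card_eq _ ((hw.mem_star _).2 ⟨j, rfl⟩).1
    exact add_le_add (basePotentialBound_le hr hr0 hT (by simp) hreg _ _)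
      (mul_le_mul_of_nonneg_right (hm _) (abs_nonneg _))
  refine le_trans ?_ (Finset.sum_le_sum fun j _ => hle j)
  rw [Finset.sum_add_distrib, ← Finset.mul_sum,
    hcount B fun x y => basePotentialBound_comm i r x q y]
  -- The actual angles add up to `2π`, so this is the triangle inequality for the deviations.
  have habs : |2 * Real.pi - (n₁ * A large large + n₂ * A large small + n₃ * A small small)|
      ≤ ∑ j ∈ Finset.range n,
        |EuclideanGeometry.angle (w j) v (w (j + 1)) - A (k j) (k (j + 1))| := by
    rw [← hcount A fun x y => tightAngle_comm _ _ _, ← hsum, ← Finset.sum_sub_distrib]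
    exact Finset.abs_sum_le_sum_abs _ _
  refine le_trans ?_ (add_le_add_right (mul_le_mul_of_nonneg_left habs hμ) _)
  refine corona_nonneg hi hr hr0 q (heven.2 hkn) ?_
  -- In the remaining corona `(1, 2, 2)` of case 5, a rotation of the cycle shows that `v` is
  -- singular, contrary to `hreg`.
  rintro ⟨rfl, hqs, hex⟩
  simp only [Prod.mk.injEq] at hex
  obtain ⟨rfl, rfl, rfl⟩ := hex
  norm_num at htotal
  subst htotal
  obtain ⟨s, s0, s1, s2, s3, s4⟩ := exists_rotation k
    (fun j => by simp only [hk, hw.add_period])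
    (by
      rw [hcount (fun x y => if x = large ∧ y = large then 1 else 0) fun x y => by
        simp only [and_comm]]
      simp)
    (by
      rw [hcount (fun x y => if x = small ∧ y = small then 1 else 0) fun x y => by
        simp only [and_comm]]
      simp)
  exact hreg rfl ((hw.shift (by norm_num) s).isSingular hqs s0 s1 s2 s3 s4)

end DiscPacking

theorem IsTargetRadius.pos {i : ℕ} (hi : i ∈ Set.Icc 1 9) {r : ℝ} (hr : IsTargetRadius i r) :
    0 < r := by
  refine lt_of_lt_of_le ?_ hr.2.1
  obtain ⟨h1, h9⟩ := hi
  interval_cases i <;> norm_num [radiusApprox]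

end DiscPack

theorem proposition1 (i : ℕ) (hi : i ∈ Set.Icc 1 9) (r : ℝ)
    (hr : DiscPack.IsTargetRadius i r)
    (P : DiscPack.DiscPacking r) (hP : P.Saturated)
    (𝒯 : Set (Finset DiscPack.Plane)) (h𝒯 : P.IsFMTriangulation 𝒯)
    (m : DiscPack.DiscType → ℝ) (hm : ∀ t, DiscPack.mLowerBound i t ≤ m t)
    (v : DiscPack.Plane) (hv : v ∈ P.centers) :
    ∃ hfin : (DiscPack.DiscPacking.star 𝒯 v).Finite,
      0 ≤ ∑ T ∈ hfin.toFinset, P.vertexPotential i 𝒯 m v T := by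
  have hr0 := hr.pos hi
  refine ⟨h𝒯.star_finite hP hr0 v, ?_⟩
  by_cases hs : i = 5 ∧ P.IsSingular 𝒯 v
  · obtain ⟨rfl, hs⟩ := hs
    refine DiscPack.DiscPacking.sum_star_nonneg_of_isSingular h𝒯 hr0 _ hs fun t => ?_
    exact (DiscPack.mLowerBound_nonneg hi t).trans (hm t)
  · exact DiscPack.DiscPacking.sum_star_nonneg hi hr hr0 hP h𝒯 hv _ (fun h5 h => hs ⟨h5, h⟩) hm
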